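/- Let $S$ be a finitely generated, cancellative, abelian semigroup (with neutral element $0$) which has no invertible elements except $0$. Regard $S$ as a subsemigroup of an abelian group $G$ (this is always possible, for example with $G=\mathbb Z^n\oplus T$, $T$ a finite abelian group), so that $S\cap(-S)=\{0\}$. For a finite family $A=(a_1,\dots,a_m)$ in $G$ and $E\subseteq\{1,\dots,m\}$ let $A^E=(a_i)_{i\in E}$, and let $\mathbb N A^E$ and $\mathbb Z A^E$ be the subsemigroup (containing $0$) and the subgroup of $G$ generated by it. Complete intersections. Let $A=(a_1,\dots,a_m)$ be any finite family of generators of $S$, let $L\subseteq\mathbb Z^m$ be the kernel of the homomorphism $\mathbb Z^m\to G$, $e_i\mapsto a_i$, and let $$I_L=\left(x^{\alpha^+}-x^{\alpha^-}\ :\ \alpha=\alpha^+-\alpha^-\in L\right)\subseteq\mathbb Q[x_1,\dots,x_m],$$ where $\alpha^+$ and $\alpha^-$ are the positive and negative parts of $\alpha$. The semigroup $S$ is a complete intersection if the minimal number of generators of the ideal $I_L$ equals the height of $I_L$. Gluing. If $E_1,E_2$ are nonempty disjoint sets with $E_1\cup E_2=\{1,\dots,m\}$, then $\mathbb N A$ is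 the gluing of $\mathbb N A^{E_1}$ and $\mathbb N A^{E_2}$ if there is a nonzero $c\in\mathbb N A^{E_1}\cap\mathbb N A^{E_2}$ with $\mathbb Z c=\mathbb Z A^{E_1}\cap\mathbb Z A^{E_2}$. A semigroup is completely glued if it belongs to the smallest class of finitely generated, cancellative, abelian semigroups with no invertible elements except $0$ that contains every semigroup generated by finitely many $\mathbb Z$-linearly independent elements of an abelian group and is closed under gluing. Theorem 3.16. For every such $S$ and every finite family of generators used to define $I_L$, the semigroup $S$ is a complete intersection if and only if it is completely glued. In particular, let $S$ be an affine semigroup, that is, a finitely generated subsemigroup of some $\mathbb Z^n$ with $S\cap(-S)=\{0\}$. Then $S$ is a complete intersection if and only if it belongs to the smallest class of affine semigroups that contains all free affine semigroups (those isomorphic to some $\mathbb N^k$) and is closed under gluing. -/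

import Mathlib

universe u

/-- A subsemigroup (with `0`) of an abelian group has no invertible elements: `S ∩ (-S) = {0}`. -/
def HasNoInvertibles {G : Type u} [AddCommGroup G] (S : AddSubmonoid G) : Prop :=
  ∀ x ∈ S, -x ∈ S → x = 0

/-- The lattice `L ⊆ ℤ^m` of relations of `a₁, …, a_m`: the kernel of the homomorphism
`ℤ^m → G`, `e_i ↦ a_i`, i.e. `v ↦ ∑ i, v i • a i`. -/
def relationLattice {G : Type u} [AddCommGroup G] {m : ℕ} (a : Fin m → G) :
    Submodule ℤ (Fin m → ℤ) :=
  LinearMap.ker (Fintype.linearCombination ℤ a)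

/-- The binomial `F(α) = x^{α⁺} - x^{α⁻}` of an integer vector `α = α⁺ - α⁻`. -/
noncomputable def latticeBinomial (K : Type*) [Field K] {m : ℕ} (α : Fin m → ℤ) :
    MvPolynomial (Fin m) K :=
  ∏ i, MvPolynomial.X i ^ (α i).toNat - ∏ i, MvPolynomial.X i ^ (-α i).toNat

/-- The lattice ideal `I_L = (F(α) : α ∈ L)` in `K[x₁, …, x_m]`. -/
noncomputable def latticeIdeal (K : Type*) [Field K] {m : ℕ} (L : Submodule ℤ (Fin m → ℤ)) :
    Ideal (MvPolynomial (Fin m) K) :=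
  Ideal.span {f | ∃ α ∈ L, f = latticeBinomial K α}

/-- An ideal (of a noetherian ring) is a complete intersection if its minimal number of generators
equals its height. -/
def IsCompleteIntersectionIdeal {R : Type*} [CommRing R] (I : Ideal R) : Prop :=
  (Submodule.spanFinrank I : ℕ∞) = I.height

/-- The semigroup `ℕA` generated by `A = {a₁, …, a_m}` is a complete intersection: the lattice
ideal of the relation lattice of `A` in `ℚ[x₁, …, x_m]` is a complete intersection. -/
def IsCompleteIntersectionSemigroup {G : Type u} [AddCommGroup G] {m : ℕ} (a : Fin m → G) : Prop :=
  IsCompleteIntersectionIdeal (latticeIdeal ℚ (relationLattice a))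

/-- For a partition of the index set into nonempty `E₁`, `E₂`, the semigroup `ℕA` is the gluing of
`ℕA^{E₁}` and `ℕA^{E₂}`: there is a nonzero `c ∈ ℕA^{E₁} ∩ ℕA^{E₂}` with
`ℤc = ℤA^{E₁} ∩ ℤA^{E₂}`. -/
def IsGluing {G : Type u} [AddCommGroup G] {m : ℕ} (a : Fin m → G) (E₁ E₂ : Set (Fin m)) : Prop :=
  E₁.Nonempty ∧ E₂.Nonempty ∧ E₁ ∪ E₂ = Set.univ ∧ E₁ ∩ E₂ = ∅ ∧
    ∃ c : G, c ≠ 0 ∧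
      c ∈ AddSubmonoid.closure (a '' E₁) ⊓ AddSubmonoid.closure (a '' E₂) ∧
      AddSubgroup.zmultiples c = AddSubgroup.closure (a '' E₁) ⊓ AddSubgroup.closure (a '' E₂)

/-- Completely glued semigroups: the smallest class of finitely generated semigroups without
invertible elements that contains the semigroups generated by finitely many linearly independent
elements and is closed under gluing. A semigroup and the two semigroups that it is glued from lie in
the same group, so that the class can be generated inside each `G` separately. -/
inductive IsCompletelyGlued {G : Type u} [AddCommGroup G] : AddSubmonoid G → Prop
  | of_linearIndependent {m : ℕ} (b : Fin m → G) (hb : LinearIndependent ℤ b) :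
      IsCompletelyGlued (AddSubmonoid.closure (Set.range b))
  | glue {m : ℕ} (a : Fin m → G) (E₁ E₂ : Set (Fin m))
      (ha : HasNoInvertibles (AddSubmonoid.closure (Set.range a)))
      (h : IsGluing a E₁ E₂)
      (h₁ : IsCompletelyGlued (AddSubmonoid.closure (a '' E₁)))
      (h₂ : IsCompletelyGlued (AddSubmonoid.closure (a '' E₂))) :
      IsCompletelyGlued (AddSubmonoid.closure (Set.range a))

/-- Completely glued affine semigroups: the smallest class of affine semigroups (finitely generated
subsemigroups of some `ℤ^n` without invertible elements) that contains the free ones (those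
isomorphic to some `ℕ^k`) and is closed under gluing. -/
inductive IsCompletelyGluedAffine {n : ℕ} : AddSubmonoid (Fin n → ℤ) → Prop
  | of_free (F : AddSubmonoid (Fin n → ℤ)) (k : ℕ) (hF : Nonempty (F ≃+ (Fin k → ℕ))) :
      IsCompletelyGluedAffine F
  | glue {m : ℕ} (a : Fin m → Fin n → ℤ) (E₁ E₂ : Set (Fin m))
      (ha : HasNoInvertibles (AddSubmonoid.closure (Set.range a)))
      (h : IsGluing a E₁ E₂)
      (h₁ : IsCompletelyGluedAffine (AddSubmonoid.closure (a '' E₁)))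
      (h₂ : IsCompletelyGluedAffine (AddSubmonoid.closure (a '' E₂))) :
      IsCompletelyGluedAffine (AddSubmonoid.closure (Set.range a))

/-! ### Combinatorics of sign patterns: every dominating pattern has a cut. -/

section MonochromaticCut

variable {V ρ : Type*} [DecidableEq V]

/-! Let r be the rank of the lattice L of relations. Modulo I_L, the kernel of K[x] → K[G],
monomials are nonzerodivisors, and so is x^u - x^v whenever the difference of the degrees has
infinite order. Hence I_L has height r (`finrank_relations_le_height`, `height_toricIdeal_le`), and
a complete intersection is the same as r generators for I_L. As S has no invertible elements, a
graded Nakayama lemma holds once zero generators are discarded. It replaces r arbitrary generators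
by at most r binomials and makes the property independent of the chosen generators of S
(`exists_pureBinomial_generators`, `HasFewGenerators.of_closure_eq`).

Gluing along c = deg x^w = deg y^z adds the single binomial x^w - y^z and raises the rank by one, so
glued semigroups inherit the property (`HasFewGenerators.of_gluing`).

Conversely, regard the at most r binomial generators as rows of a sign pattern whose columns are the
variables. If at least |C| rows had both monomials meeting a nonempty set C of variables, one could
trade these rows for the variables in C: a minimal prime over the resulting ideal of at most r
generators would contain I_L and a variable, so its height would exceed r, against Krull
(`isDominating_binomialRow`). The combinatorial core is `IsDominating.exists_rowCut`: such a pattern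
has a set E of columns that separates the two monomials of exactly one row and cuts no other row.
The common degree of these two monomials is the glueing element
(`closure_inf_closure_le_zmultiples`), the uncut rows generate the toric ideals of the two sides
(`exists_toricIdeal_restrict_eq`), and induction on the number of generators finishes the proof. -/

/-- The rows of `R` that are mixed on `C`, for a sign pattern given by the supports `Q i true` and
`Q i false` of the positive and the negative entries of row `i`. -/
def mixedRows (R : Finset ρ) (Q : ρ → Bool → Finset V) (C : Finset V) : Finset ρ :=
  R.filter fun i => ∀ s, (Q i s ∩ C).Nonempty

/-- A sign pattern is dominating if every nonempty set of columns has more columns than mixed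
rows. -/
def IsDominating (R : Finset ρ) (Q : ρ → Bool → Finset V) : Prop :=
  ∀ C : Finset V, C.Nonempty → (mixedRows R Q C).card < C.card

/-- The set `E` cuts the row `j` into its positive and its negative part and does not cut any other
row. -/
def IsRowCut (R : Finset ρ) (Q : ρ → Bool → Finset V) (j : ρ) (E : Finset V) : Prop :=
  (∃ s, Q j s ⊆ E ∧ Disjoint (Q j !s) E) ∧
    ∀ i ∈ R, i ≠ j → (∀ s, Q i s ⊆ E) ∨ ∀ s, Disjoint (Q i s) E

lemma mixedRows_card_mono {R R' : Finset ρ} (h : R ⊆ R') (Q : ρ → Bool → Finset V) (C : Finset V) :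
    (mixedRows R Q C).card ≤ (mixedRows R' Q C).card :=
  Finset.card_le_card (Finset.filter_subset_filter _ h)

/-- A cut has no preferred side, which permits the normalization that a given uncut row, or a given
half of the cut row, lies inside. -/
lemma IsRowCut.compl [Fintype V] {R : Finset ρ} {Q : ρ → Bool → Finset V} {j : ρ} {E : Finset V}
    (h : IsRowCut R Q j E) : IsRowCut R Q j Eᶜ := by
  obtain ⟨⟨s, hs, hs'⟩, h⟩ := h
  refine ⟨⟨!s, ?_, ?_⟩, fun i hi hij => ?_⟩
  · exact Finset.subset_compl_iff_disjoint_right.2 hs'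
  · rw [Bool.not_not]
    exact disjoint_compl_right_iff.2 hs
  · rcases h i hi hij with h | h
    · exact Or.inr fun s => disjoint_compl_right_iff.2 (h s)
    · exact Or.inl fun s => Finset.subset_compl_iff_disjoint_right.2 (h s)

variable [DecidableEq ρ]

/-- The rows other than `i` and `j` that are supported in `A`. -/
def rowsWithin (R : Finset ρ) (Q : ρ → Bool → Finset V) (i j : ρ) (A : Finset V) : Finset ρ :=
  R.filter fun k => k ≠ i ∧ k ≠ j ∧ ∀ s, Q k s ⊆ A

/-- A set of columns in `A` that meets `U` and `W` and on which as many rows within `A` are mixed as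
a dominating pattern permits. -/
def TightlyJoined (R : Finset ρ) (Q : ρ → Bool → Finset V) (i j : ρ) (A U W : Finset V) : Prop :=
  ∃ C ⊆ A, (U ∩ C).Nonempty ∧ (W ∩ C).Nonempty ∧
    C.card ≤ (mixedRows (rowsWithin R Q i j A) Q C).card + 1

variable [Fintype V]

/-- Replacing the row `j` of a dominating pattern by a new row `(U, W)` within `A`, keeping the other
rows within `A`, and cutting the result. -/
lemma exists_rowCut_or_separation {R : Finset ρ} {Q : ρ → Bool → Finset V} {i j : ρ}
    {A U W : Finset V} {t : Bool} (hi : i ∈ R) (hj : j ∈ R) (hij : i ≠ j)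
    (ih : ∀ (R' : Finset ρ) (Q' : ρ → Bool → Finset V), R'.card < R.card → R'.Nonempty →
      (∀ k ∈ R', ∀ s, (Q' k s).Nonempty) → IsDominating R' Q' → ∃ l ∈ R', ∃ E, IsRowCut R' Q' l E)
    (hQ : ∀ k ∈ R, ∀ s, (Q k s).Nonempty) (hdom : IsDominating R Q)
    (hA : ∀ k ∈ R, k ≠ i → k ≠ j → (∀ s, Q k s ⊆ A) ∨ ∀ s, Disjoint (Q k s) A)
    (hit' : Disjoint (Q i !t) A) (hUA : U ⊆ A) (hWA : W ⊆ A)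
    (hU : U.Nonempty) (hW : W.Nonempty) (hiUW : Q i t ⊆ U ∪ W) (hjUW : ∀ s, Q j s ∩ A ⊆ U ∪ W)
    (hUW : ¬ TightlyJoined R Q i j A U W) :
    (∃ l ∈ R, ∃ E, IsRowCut R Q l E) ∨ ∃ F ⊆ A, U ⊆ F ∧ Disjoint W F ∧
      ∀ k ∈ R, k ≠ i → k ≠ j → (∀ s, Q k s ⊆ F) ∨ ∀ s, Disjoint (Q k s) F := by
  set RA := rowsWithin R Q i j A with hRA
  set Q' := Function.update Q j fun s => cond s U W with hQ'
  have hjRA : j ∉ RA := by simp [hRA, rowsWithin]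
  have hne : ∀ k ∈ RA, k ≠ j := fun k hk h => hjRA (h ▸ hk)
  have hQk : ∀ k ∈ RA, Q' k = Q k := fun k hk => Function.update_of_ne (hne k hk) _ _
  have hQj : Q' j = fun s => cond s U W := Function.update_self _ _ _
  have hsub : RA ⊆ R := Finset.filter_subset _ _
  have hRA' : ∀ k ∈ RA, ∀ s, Q k s ⊆ A := fun k hk => (Finset.mem_filter.1 hk).2.2.2
  have hsub' : insert j RA ⊆ R := Finset.insert_subset hj hsub
  have hmixRA : ∀ C, mixedRows RA Q' C = mixedRows RA Q C := fun C =>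
    Finset.filter_congr fun k hk => by rw [hQk k hk]
  have hcap : ∀ C, mixedRows RA Q C = mixedRows RA Q (A ∩ C) := fun C =>
    Finset.filter_congr fun k hk => forall_congr' fun s => by
      rw [← Finset.inter_assoc, Finset.inter_eq_left.2 (hRA' k hk s)]
  obtain ⟨l, hl, E, hE⟩ := ih (insert j RA) Q'
    (Finset.card_lt_card ⟨hsub', fun h => by
      have := h hi
      rw [Finset.mem_insert] at this
      rcases this with h | h
      · exact hij h
      · simp [hRA, rowsWithin] at h⟩)
    ⟨j, Finset.mem_insert_self _ _⟩
    (fun k hk s => by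
      rcases Finset.mem_insert.1 hk with rfl | hk
      · rw [hQj]; cases s
        · exact hW
        · exact hU
      · rw [hQk k hk]; exact hQ k (hsub hk) s)
    -- Passing from `C` to `A ∩ C` loses no mixed row of `RA`. So if domination failed at a `C` on
    -- which the new row is mixed, `A ∩ C` would join `U` and `W` tightly.
    (fun C hC => by
      have hlt := (mixedRows_card_mono hsub Q C).trans_lt (hdom C hC)
      unfold mixedRows
      rw [Finset.filter_insert]
      split_ifs with h
      · rw [Finset.card_insert_of_notMem fun h => hjRA (Finset.mem_filter.1 h).1]
        by_contra hcon
        refine hUW ⟨A ∩ C, Finset.inter_subset_left, ?_, ?_, ?_⟩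
        · have := h true
          rw [hQj] at this
          rwa [← Finset.inter_assoc, Finset.inter_eq_left.2 hUA]
        · have := h false
          rw [hQj] at this
          rwa [← Finset.inter_assoc, Finset.inter_eq_left.2 hWA]
        · rw [← hcap, ← hmixRA]
          exact (Finset.card_le_card Finset.inter_subset_right).trans (not_lt.1 hcon)
      · change (mixedRows RA Q' C).card < _
        rw [hmixRA]
        exact hlt)
  rcases Finset.mem_insert.1 hl with rfl | hlA
  · right
    obtain ⟨F, hF, hUF, hWF⟩ : ∃ F, IsRowCut (insert l RA) Q' l F ∧ U ⊆ F ∧ Disjoint W F := by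
      obtain ⟨s, hs, hs'⟩ := hE.1
      rw [hQj] at hs hs'
      cases s
      · exact ⟨Eᶜ, hE.compl, Finset.subset_compl_iff_disjoint_right.2 hs',
          disjoint_compl_right_iff.2 hs⟩
      · exact ⟨E, hE, hs, hs'⟩
    refine ⟨F ∩ A, Finset.inter_subset_right, Finset.subset_inter hUF hUA,
      hWF.mono_right Finset.inter_subset_left, fun k hk hki hkj => ?_⟩
    rcases hA k hk hki hkj with h | h
    · have hkA : k ∈ RA := Finset.mem_filter.2 ⟨hk, hki, hkj, h⟩
      have := hF.2 k (Finset.mem_insert_of_mem hkA) hkj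
      rw [hQk k hkA] at this
      rcases this with h' | h'
      · exact Or.inl fun s => Finset.subset_inter (h' s) (h s)
      · exact Or.inr fun s => (h' s).mono_right Finset.inter_subset_left
    · exact Or.inr fun s => (h s).mono_right Finset.inter_subset_right
  · left
    have hlj := hne l hlA
    obtain ⟨F, hF, hF'⟩ : ∃ F, IsRowCut (insert j RA) Q' l F ∧ U ∪ W ⊆ F := by
      rcases hE.2 j (Finset.mem_insert_self _ _) hlj.symm with h | h
      · rw [hQj] at h
        exact ⟨E, hE, Finset.union_subset (h true) (h false)⟩
      · rw [hQj] at h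
        exact ⟨Eᶜ, hE.compl, Finset.union_subset
          (Finset.subset_compl_iff_disjoint_right.2 (h true))
          (Finset.subset_compl_iff_disjoint_right.2 (h false))⟩
    have hdis : ∀ T : Finset V, Disjoint T F → T ⊆ A → Disjoint T (F ∪ Aᶜ) := fun T h h' =>
      Finset.disjoint_union_right.2 ⟨h, disjoint_compl_right_iff.2 h'⟩
    -- Adding `Aᶜ` swallows everything outside `A`: all rows there, the half of row `i` there, and
    -- the rest of row `j`. The parts of rows `i` and `j` in `A` lie in `U ∪ W ⊆ F`.
    refine ⟨l, hsub hlA, F ∪ Aᶜ, ?_, fun k hk hkl => ?_⟩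
    · obtain ⟨s, hs, hs'⟩ := hF.1
      rw [hQk l hlA] at hs hs'
      exact ⟨s, hs.trans Finset.subset_union_left, hdis _ hs' (hRA' l hlA _)⟩
    · by_cases hki : k = i
      · left
        subst hki
        have h1 : Q k t ⊆ F ∪ Aᶜ := (hiUW.trans hF').trans Finset.subset_union_left
        have h2 : Q k (!t) ⊆ F ∪ Aᶜ :=
          (Finset.subset_compl_iff_disjoint_right.2 hit').trans Finset.subset_union_right
        intro s
        cases s <;> cases t <;> assumption
      by_cases hkj : k = j
      · left
        subst hkj
        intro s x hx
        by_cases hxA : x ∈ A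
        · exact Finset.mem_union_left _ (hF' (hjUW s (Finset.mem_inter.2 ⟨hx, hxA⟩)))
        · exact Finset.mem_union_right _ (Finset.mem_compl.2 hxA)
      rcases hA k hk hki hkj with h | h
      · have hkA : k ∈ RA := Finset.mem_filter.2 ⟨hk, hki, hkj, h⟩
        have := hF.2 k (Finset.mem_insert_of_mem hkA) hkl
        rw [hQk k hkA] at this
        rcases this with h' | h'
        · exact Or.inl fun s => (h' s).trans Finset.subset_union_left
        · exact Or.inr fun s => hdis _ (h' s) (h s)
      · exact Or.inl fun s => (Finset.subset_compl_iff_disjoint_right.2 (h s)).trans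
          Finset.subset_union_right

/-- Every dominating sign pattern with at least one row, in which all rows are mixed, has a cut. -/
theorem IsDominating.exists_rowCut (n : ℕ) : ∀ (R : Finset ρ) (Q : ρ → Bool → Finset V),
    R.card = n → R.Nonempty → (∀ k ∈ R, ∀ s, (Q k s).Nonempty) → IsDominating R Q →
      ∃ j ∈ R, ∃ E, IsRowCut R Q j E := by
  induction n using Nat.strong_induction_on with
  | _ n ihn =>
  intro R Q hn hR hQ hdom
  have ih : ∀ (R' : Finset ρ) (Q' : ρ → Bool → Finset V), R'.card < R.card → R'.Nonempty →
      (∀ k ∈ R', ∀ s, (Q' k s).Nonempty) → IsDominating R' Q' →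
      ∃ l ∈ R', ∃ E, IsRowCut R' Q' l E :=
    fun R' Q' h => ihn R'.card (hn ▸ h) R' Q' rfl
  obtain ⟨j, hj⟩ := hR
  -- Domination at one-column sets says that no row has a column in both halves.
  have hcut1 : ∀ k ∈ R, ∀ s, Disjoint (Q k s) (Q k !s) := by
    intro k hk s
    rw [Finset.disjoint_left]
    intro x hx hx'
    have := hdom {x} ⟨x, Finset.mem_singleton_self x⟩
    rw [Finset.card_singleton, Nat.lt_one_iff, Finset.card_eq_zero] at this
    have hk' : k ∈ mixedRows R Q {x} := Finset.mem_filter.2 ⟨hk, fun u => ⟨x, by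
      cases u <;> cases s <;> simp_all⟩⟩
    simp [this] at hk'
  rcases (R.erase j).eq_empty_or_nonempty with h0 | h0
  · refine ⟨j, hj, Q j true, ⟨true, subset_rfl, (hcut1 j hj true).symm⟩, fun k hk hkj => ?_⟩
    have : k ∈ R.erase j := Finset.mem_erase.2 ⟨hkj, hk⟩
    simp [h0] at this
  obtain ⟨i, hi', A, hA⟩ := ih (R.erase j) Q (Finset.card_erase_lt_of_mem hj) h0
    (fun k hk => hQ k (Finset.mem_of_mem_erase hk))
    (fun C hC => (mixedRows_card_mono (Finset.erase_subset _ _) Q C).trans_lt (hdom C hC))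
  have hi := Finset.mem_of_mem_erase hi'
  have hij : i ≠ j := Finset.ne_of_mem_erase hi'
  obtain ⟨⟨t, hit, hit'⟩, hA⟩ := hA
  replace hA : ∀ k ∈ R, k ≠ i → k ≠ j → (∀ s, Q k s ⊆ A) ∨ ∀ s, Disjoint (Q k s) A :=
    fun k hk hki hkj => hA k (Finset.mem_erase.2 ⟨hkj, hk⟩) hki
  by_cases hcross : (∀ s, Q j s ⊆ A) ∨ ∀ s, Disjoint (Q j s) A
  · refine ⟨i, hi, A, ⟨t, hit, hit'⟩, fun k hk hki => ?_⟩
    by_cases hkj : k = j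
    · rwa [hkj]
    · exact hA k hk hki hkj
  push Not at hcross
  obtain ⟨⟨s₁, hs₁⟩, s₂, hs₂⟩ := hcross
  have hBc : ∀ k ∈ R, k ≠ i → k ≠ j → (∀ s, Q k s ⊆ Aᶜ) ∨ ∀ s, Disjoint (Q k s) Aᶜ :=
    fun k hk hki hkj => (hA k hk hki hkj).symm.imp
      (fun h s => Finset.subset_compl_iff_disjoint_right.2 (h s))
      (fun h s => disjoint_compl_right_iff.2 (h s))
  -- If `Q i u` is tightly joined to neither half of row `j` inside `B`, it can be separated from
  -- all of row `j` there; the separating set then cuts row `i` only.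
  have key0 : ∀ (B : Finset V) (u : Bool),
      (∀ k ∈ R, k ≠ i → k ≠ j → (∀ s, Q k s ⊆ B) ∨ ∀ s, Disjoint (Q k s) B) →
      Q i u ⊆ B → Disjoint (Q i !u) B → (∃ s, ¬ Disjoint (Q j s) B) →
      (∀ s, ¬ TightlyJoined R Q i j B (Q i u) (Q j s ∩ B)) → ∃ l ∈ R, ∃ E, IsRowCut R Q l E := by
    rintro B u hB hu hu' ⟨s, hs⟩ hX
    have hsub : ∀ s, Q j s ∩ B ⊆ (Q j true ∪ Q j false) ∩ B := fun s =>
      Finset.inter_subset_inter_right (by cases s <;> simp)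
    rcases exists_rowCut_or_separation (U := Q i u) (W := (Q j true ∪ Q j false) ∩ B) hi hj hij ih
      hQ hdom hB hu' hu Finset.inter_subset_right (hQ i hi u)
      ((Finset.not_disjoint_iff_nonempty_inter.1 hs).mono (hsub s)) Finset.subset_union_left
      (fun s => (hsub s).trans Finset.subset_union_right)
      (by
        rintro ⟨C, hC, hU, ⟨x, hx⟩, hcard⟩
        simp only [Finset.mem_inter, Finset.mem_union] at hx
        rcases hx with ⟨⟨hx | hx, hxB⟩, hxC⟩
        · exact hX true ⟨C, hC, hU, ⟨x, by simp [*]⟩, hcard⟩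
        · exact hX false ⟨C, hC, hU, ⟨x, by simp [*]⟩, hcard⟩) with h | ⟨F, hFB, hUF, hWF, hF⟩
    · exact h
    · refine ⟨i, hi, F, ⟨u, hUF, hu'.mono_right hFB⟩, fun k hk hki => ?_⟩
      by_cases hkj : k = j
      · right
        subst hkj
        intro s
        rw [Finset.disjoint_left]
        intro x hx hxF
        exact Finset.disjoint_left.1 hWF (hsub s (Finset.mem_inter.2 ⟨hx, hFB hxF⟩)) hxF
      · exact hF k hk hki hkj
  -- If `Q i u` is not tightly joined to the half `!s` of row `j` inside `B`, that half can be
  -- separated from `Q i u` together with the other half. This gives one side's contribution to a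
  -- cut of row `j`.
  have key1 : ∀ (B : Finset V) (u s : Bool),
      (∀ k ∈ R, k ≠ i → k ≠ j → (∀ s, Q k s ⊆ B) ∨ ∀ s, Disjoint (Q k s) B) →
      Q i u ⊆ B → Disjoint (Q i !u) B →
      ¬ TightlyJoined R Q i j B (Q i u) (Q j (!s) ∩ B) → (∃ l ∈ R, ∃ E, IsRowCut R Q l E) ∨
        ∃ F ⊆ B, Q i u ⊆ F ∧ Q j s ∩ B ⊆ F ∧ Disjoint (Q j !s) F ∧
          ∀ k ∈ R, k ≠ i → k ≠ j → (∀ s, Q k s ⊆ F) ∨ ∀ s, Disjoint (Q k s) F := by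
    intro B u s hB hu hu' hX
    by_cases hW : Disjoint (Q j !s) B
    · exact Or.inr ⟨B, subset_rfl, hu, Finset.inter_subset_right, hW, hB⟩
    rcases exists_rowCut_or_separation (U := Q i u ∪ (Q j s ∩ B)) (W := Q j (!s) ∩ B) hi hj hij ih
      hQ hdom hB hu' (Finset.union_subset hu Finset.inter_subset_right) Finset.inter_subset_right
      ((hQ i hi u).mono Finset.subset_union_left)
      (Finset.not_disjoint_iff_nonempty_inter.1 hW)
      (Finset.subset_union_left.trans Finset.subset_union_left)
      (fun s' => by
        intro x hx
        simp only [Finset.mem_union]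
        cases s <;> cases s' <;> simp_all)
      (by
        rintro ⟨C, hC, ⟨x, hx⟩, hW, hcard⟩
        rw [Finset.union_inter_distrib_right, Finset.mem_union] at hx
        rcases hx with hx | hx
        · exact hX ⟨C, hC, ⟨x, hx⟩, hW, hcard⟩
        -- A tight `C` meeting both halves of row `j` is impossible: row `j` is one more mixed row
        -- than domination allows.
        · have hjC : j ∈ mixedRows R Q C := by
            refine Finset.mem_filter.2 ⟨hj, fun s' => ?_⟩
            have h1 : (Q j s ∩ C).Nonempty := ⟨x, by
              simp only [Finset.mem_inter] at hx ⊢; exact ⟨hx.1.1, hx.2⟩⟩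
            have h2 : (Q j (!s) ∩ C).Nonempty := hW.mono
              (Finset.inter_subset_inter_right Finset.inter_subset_left)
            cases s <;> cases s' <;> assumption
          have hlt : (mixedRows (rowsWithin R Q i j B) Q C).card < (mixedRows R Q C).card :=
            Finset.card_lt_card (Finset.ssubset_iff_of_subset
              (Finset.filter_subset_filter _ (Finset.filter_subset _ _)) |>.2 ⟨j, hjC, fun h => by
                simp at h⟩)
          have := hdom C ⟨x, (Finset.mem_inter.1 hx).2⟩
          omega) with h | ⟨F, hFB, hUF, hWF, hF⟩
    · exact Or.inl h
    · refine Or.inr ⟨F, hFB, Finset.subset_union_left.trans hUF,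
        Finset.subset_union_right.trans hUF, ?_, hF⟩
      rw [Finset.disjoint_left] at hWF ⊢
      exact fun x hx hxF => hWF (Finset.mem_inter.2 ⟨hx, hFB hxF⟩) hxF
  have hiB : Q i (!t) ⊆ Aᶜ := Finset.subset_compl_iff_disjoint_right.2 hit'
  have hiB' : Disjoint (Q i !!t) Aᶜ := by
    rw [Bool.not_not]; exact disjoint_compl_right_iff.2 hit
  by_cases hX : ∀ s, ¬ TightlyJoined R Q i j A (Q i t) (Q j s ∩ A)
  · exact key0 A t hA hit hit' ⟨s₂, hs₂⟩ hX
  by_cases hY : ∀ s, ¬ TightlyJoined R Q i j Aᶜ (Q i !t) (Q j s ∩ Aᶜ)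
  · exact key0 Aᶜ (!t) hBc hiB hiB' ⟨s₁, fun h => hs₁ (disjoint_compl_right_iff.1 h)⟩ hY
  -- Tight sets `C` and `D` on the two sides that reach opposite halves of row `j` would make both
  -- `i` and `j` mixed on `C ∪ D`. With the `|C| - 1` and `|D| - 1` mixed rows within the sides this
  -- makes at least `|C ∪ D|` mixed rows.
  have hXY : ∀ s, TightlyJoined R Q i j A (Q i t) (Q j s ∩ A) →
      ¬ TightlyJoined R Q i j Aᶜ (Q i !t) (Q j (!s) ∩ Aᶜ) := by
    rintro s ⟨C, hC, ⟨x, hx⟩, ⟨y, hy⟩, hCc⟩ ⟨D, hD, ⟨x', hx'⟩, ⟨y', hy'⟩, hDc⟩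
    simp only [Finset.mem_inter] at hx hy hx' hy'
    have hCD : Disjoint C D := disjoint_compl_right.mono hC hD
    have hlt := hdom (C ∪ D) ⟨x, Finset.mem_union_left _ hx.2⟩
    rw [Finset.card_union_of_disjoint hCD] at hlt
    have hiCD : i ∈ mixedRows R Q (C ∪ D) := Finset.mem_filter.2 ⟨hi, fun u => by
      have h1 : (Q i t ∩ (C ∪ D)).Nonempty := ⟨x, by simp [hx]⟩
      have h2 : (Q i (!t) ∩ (C ∪ D)).Nonempty := ⟨x', by simp [hx']⟩
      cases u <;> cases t <;> assumption⟩
    have hjCD : j ∈ mixedRows R Q (C ∪ D) := Finset.mem_filter.2 ⟨hj, fun u => by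
      have h1 : (Q j s ∩ (C ∪ D)).Nonempty := ⟨y, by simp [hy]⟩
      have h2 : (Q j (!s) ∩ (C ∪ D)).Nonempty := ⟨y', by simp [hy']⟩
      cases u <;> cases s <;> assumption⟩
    set M₁ := mixedRows (rowsWithin R Q i j A) Q C
    set M₂ := mixedRows (rowsWithin R Q i j Aᶜ) Q D
    have hM₁ : ∀ k ∈ M₁, k ∈ mixedRows R Q (C ∪ D) ∧ k ≠ i ∧ k ≠ j ∧ ∀ s, Q k s ⊆ A := by
      intro k hk
      simp only [M₁, mixedRows, rowsWithin, Finset.mem_filter] at hk ⊢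
      exact ⟨⟨hk.1.1, fun s => (hk.2 s).mono
        (Finset.inter_subset_inter_left Finset.subset_union_left)⟩, hk.1.2⟩
    have hM₂ : ∀ k ∈ M₂, k ∈ mixedRows R Q (C ∪ D) ∧ k ≠ i ∧ k ≠ j ∧ ∀ s, Q k s ⊆ Aᶜ := by
      intro k hk
      simp only [M₂, mixedRows, rowsWithin, Finset.mem_filter] at hk ⊢
      exact ⟨⟨hk.1.1, fun s => (hk.2 s).mono
        (Finset.inter_subset_inter_left Finset.subset_union_right)⟩, hk.1.2⟩
    have hdisj : Disjoint M₁ M₂ := by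
      rw [Finset.disjoint_left]
      intro k h1 h2
      obtain ⟨z, hz⟩ := hQ k (Finset.mem_filter.1 (hM₁ k h1).1).1 true
      exact Finset.mem_compl.1 ((hM₂ k h2).2.2.2 true hz) ((hM₁ k h1).2.2.2 true hz)
    have hsub : insert i (insert j (M₁ ∪ M₂)) ⊆ mixedRows R Q (C ∪ D) :=
      Finset.insert_subset hiCD (Finset.insert_subset hjCD (Finset.union_subset
        (fun k hk => (hM₁ k hk).1) fun k hk => (hM₂ k hk).1))
    have hcard := Finset.card_le_card hsub
    rw [Finset.card_insert_of_notMem, Finset.card_insert_of_notMem,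
      Finset.card_union_of_disjoint hdisj] at hcard
    · omega
    · rw [Finset.mem_union]
      rintro (h | h)
      · exact (hM₁ j h).2.2.1 rfl
      · exact (hM₂ j h).2.2.1 rfl
    · rw [Finset.mem_insert, Finset.mem_union]
      rintro (h | h | h)
      · exact hij h
      · exact (hM₁ i h).2.1 rfl
      · exact (hM₂ i h).2.1 rfl
  push Not at hX hY
  obtain ⟨s, hXs⟩ := hX
  obtain ⟨s', hYs'⟩ := hY
  -- Both sides are tight with the same half of row `j`, hence neither is tight with the other half,
  -- and `key1` applies on both sides.
  have hss : s' = s := by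
    by_contra hne
    rw [Bool.eq_not.2 hne] at hYs'
    exact hXY s hXs hYs'
  subst hss
  rcases key1 A t s' hA hit hit' (fun h => hXY (!s') h (by rwa [Bool.not_not])) with
    h | ⟨F₁, hF₁A, hiF₁, hjF₁, hjF₁', hF₁⟩
  · exact h
  rcases key1 Aᶜ (!t) s' hBc hiB hiB' (hXY s' hXs) with h | ⟨F₂, hF₂A, hiF₂, hjF₂, hjF₂', hF₂⟩
  · exact h
  refine ⟨j, hj, F₁ ∪ F₂, ⟨s', fun x hx => ?_, Finset.disjoint_union_right.2 ⟨hjF₁', hjF₂'⟩⟩,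
    fun k hk hkj => ?_⟩
  · by_cases hxA : x ∈ A
    · exact Finset.mem_union_left _ (hjF₁ (Finset.mem_inter.2 ⟨hx, hxA⟩))
    · exact Finset.mem_union_right _ (hjF₂ (Finset.mem_inter.2 ⟨hx, Finset.mem_compl.2 hxA⟩))
  · by_cases hki : k = i
    · left
      subst hki
      have h1 := hiF₁.trans (Finset.subset_union_left (s₂ := F₂))
      have h2 := hiF₂.trans (Finset.subset_union_right (s₁ := F₁))
      intro s
      cases s <;> cases t <;> assumption
    · rcases hF₁ k hk hki hkj with h | h
      · exact Or.inl fun s => (h s).trans Finset.subset_union_left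
      · rcases hF₂ k hk hki hkj with h' | h'
        · exact Or.inl fun s => (h' s).trans Finset.subset_union_right
        · exact Or.inr fun s => Finset.disjoint_union_right.2 ⟨h s, h' s⟩

end MonochromaticCut

open Finsupp (weight)

/-! ### Toric ideals and their nonzerodivisors. -/

section ToricIdeal

variable (K : Type*) [Field K] {G : Type*} [AddCommGroup G] {ι : Type*}

/-- The homomorphism `K[x_i : i ∈ ι] → K[G]` with `x_i ↦ a i`. -/
noncomputable def toricHom (a : ι → G) : MvPolynomial ι K →ₐ[K] AddMonoidAlgebra K G :=
  MvPolynomial.aeval fun i => AddMonoidAlgebra.single (a i) 1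

/-- The ideal of the relations between the elements `a i` in the group algebra. -/
noncomputable def toricIdeal (a : ι → G) : Ideal (MvPolynomial ι K) :=
  RingHom.ker (toricHom K a)

/-- The difference of two monomials. -/
noncomputable def pureBinomial (u v : ι →₀ ℕ) : MvPolynomial ι K :=
  MvPolynomial.monomial u 1 - MvPolynomial.monomial v 1

variable {K}

lemma toricHom_X (a : ι → G) (i : ι) :
    toricHom K a (MvPolynomial.X i) = AddMonoidAlgebra.single (a i) 1 :=
  MvPolynomial.aeval_X _ _

lemma toricHom_monomial (a : ι → G) (u : ι →₀ ℕ) (c : K) :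
    toricHom K a (MvPolynomial.monomial u c) = AddMonoidAlgebra.single (weight a u) c := by
  induction u using Finsupp.induction_linear generalizing c with
  | zero =>
    rw [map_zero, MvPolynomial.monomial_zero', ← MvPolynomial.algebraMap_eq, AlgHom.commutes]
    rfl
  | add u v hu hv =>
    rw [← mul_one c, ← MvPolynomial.monomial_mul, map_mul, hu, hv,
      AddMonoidAlgebra.single_mul_single, map_add]
  | single i n =>
    rw [MvPolynomial.monomial_eq, map_mul, ← MvPolynomial.algebraMap_eq, AlgHom.commutes]
    rw [Finsupp.prod_single_index (by exact pow_zero _), map_pow, toricHom_X, AddMonoidAlgebra.single_pow,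
      Finsupp.weight_single, ← Algebra.smul_def, AddMonoidAlgebra.smul_single]
    simp

lemma mem_toricIdeal {a : ι → G} {f : MvPolynomial ι K} :
    f ∈ toricIdeal K a ↔ toricHom K a f = 0 := RingHom.mem_ker

lemma pureBinomial_mem_toricIdeal {a : ι → G} {u v : ι →₀ ℕ} :
    pureBinomial K u v ∈ toricIdeal K a ↔ weight a u = weight a v := by
  rw [mem_toricIdeal, pureBinomial, map_sub, toricHom_monomial, toricHom_monomial, sub_eq_zero,
    AddMonoidAlgebra.single_left_inj one_ne_zero]

/-- The toric ideal is spanned by binomials as a vector space. -/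
lemma mem_of_mem_toricIdeal {a : ι → G} {D : Submodule K (MvPolynomial ι K)}
    (hD : ∀ u v : ι →₀ ℕ, weight a u = weight a v → pureBinomial K u v ∈ D) {f : MvPolynomial ι K}
    (hf : f ∈ toricIdeal K a) : f ∈ D := by
  classical
  -- One exponent is chosen for each degree. Then `τ` sends an element of the group algebra to the
  -- class of the polynomial with the chosen monomials, and `τ ∘ toricHom` is reduction modulo `D`.
  -- The default 0 is harmless, as only degrees that occur are evaluated.
  let σ : G → (ι →₀ ℕ) := fun g => if h : ∃ u : ι →₀ ℕ, weight a u = g then h.choose else 0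
  have hσ : ∀ u : ι →₀ ℕ, weight a (σ (weight a u)) = weight a u := by
    intro u
    have h : ∃ v : ι →₀ ℕ, weight a v = weight a u := ⟨u, rfl⟩
    simp only [σ, dif_pos h]
    exact h.choose_spec
  let τ : AddMonoidAlgebra K G →ₗ[K] (MvPolynomial ι K ⧸ D) :=
    (Finsupp.linearCombination K fun g => D.mkQ (MvPolynomial.monomial (σ g) 1)).comp
      (AddMonoidAlgebra.coeffLinearEquiv K).toLinearMap
  have hτ : ∀ f, τ (toricHom K a f) = D.mkQ f := by
    intro f
    induction f using MvPolynomial.induction_on' with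
    | add p q hp hq => rw [map_add, map_add, hp, hq, map_add]
    | monomial u c =>
      have h1 : τ (AddMonoidAlgebra.single (weight a u) c) =
          c • D.mkQ (MvPolynomial.monomial (σ (weight a u)) 1) := by
        simp [τ]
      have h2 : (MvPolynomial.monomial u c : MvPolynomial ι K) =
          c • MvPolynomial.monomial u 1 := by
        rw [MvPolynomial.smul_monomial, smul_eq_mul, mul_one]
      rw [toricHom_monomial, h1, h2, map_smul]
      congr 1
      rw [← sub_eq_zero, ← map_sub]
      exact (Submodule.Quotient.mk_eq_zero D).2 (hD _ _ (hσ u))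
  have := hτ f
  rw [mem_toricIdeal.1 hf, map_zero] at this
  exact (Submodule.Quotient.mk_eq_zero D).1 this.symm

lemma toricIdeal_le {a : ι → G} {J : Ideal (MvPolynomial ι K)}
    (hJ : ∀ u v : ι →₀ ℕ, weight a u = weight a v → pureBinomial K u v ∈ J) : toricIdeal K a ≤ J :=
  fun _ hf => mem_of_mem_toricIdeal (D := J.restrictScalars K) hJ hf

lemma isUnit_single (g : G) : IsUnit (AddMonoidAlgebra.single g (1 : K)) :=
  IsUnit.of_mul_eq_one (AddMonoidAlgebra.single (-g) 1) (by
    rw [AddMonoidAlgebra.single_mul_single, add_neg_cancel, one_mul]; rfl)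

lemma monomial_mul_mem_toricIdeal {a : ι → G} {u : ι →₀ ℕ} {f : MvPolynomial ι K} :
    MvPolynomial.monomial u 1 * f ∈ toricIdeal K a ↔ f ∈ toricIdeal K a := by
  rw [mem_toricIdeal, mem_toricIdeal, map_mul, toricHom_monomial,
    (isUnit_single _).mul_right_eq_zero]

/-- The coefficients of an annihilated element are periodic under `g - h`; as this has infinite
order, a nonzero coefficient would make the support infinite. -/
lemma single_sub_single_mul_eq_zero {g h : G} (hgh : ∀ n : ℕ, n • (g - h) = 0 → n = 0)
    {f : AddMonoidAlgebra K G}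
    (hf : (AddMonoidAlgebra.single g 1 - AddMonoidAlgebra.single h 1) * f = 0) : f = 0 := by
  have hper : ∀ x, f.coeff (x + (g - h)) = f.coeff x := by
    intro x
    rw [sub_mul, sub_eq_zero] at hf
    have := congrArg (fun p => p.coeff (g + x)) hf
    simp only [AddMonoidAlgebra.coeff_single_mul_apply, one_mul] at this
    rw [show x + (g - h) = -h + (g + x) by abel, ← this, neg_add_cancel_left]
  by_contra hne
  obtain ⟨x, hx⟩ : ∃ x, f.coeff x ≠ 0 := by
    by_contra! h0
    exact hne (AddMonoidAlgebra.ext (Finsupp.ext h0))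
  have hn : ∀ n : ℕ, f.coeff (x + n • (g - h)) ≠ 0 := by
    intro n
    induction n with
    | zero => simpa using hx
    | succ n ih => rwa [succ_nsmul, ← add_assoc, hper]
  refine Set.infinite_of_injective_forall_mem (f := fun n : ℕ => x + n • (g - h)) ?_
    (fun n => Finsupp.mem_support_iff.2 (hn n)) f.coeff.support.finite_toSet
  have aux : ∀ m n : ℕ, m ≤ n → m • (g - h) = n • (g - h) → m = n := by
    intro m n hmn h
    have := hgh (n - m) (by rw [sub_nsmul _ hmn, h, add_neg_cancel])
    omega
  intro m n hmn
  have hmn' : m • (g - h) = n • (g - h) := add_left_cancel hmn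
  rcases le_total m n with h | h
  · exact aux m n h hmn'
  · exact (aux n m h hmn'.symm).symm

lemma pureBinomial_mul_mem_toricIdeal {a : ι → G} {u v : ι →₀ ℕ}
    (huv : ∀ n : ℕ, n • (weight a u - weight a v) = 0 → n = 0) {f : MvPolynomial ι K}
    (hf : pureBinomial K u v * f ∈ toricIdeal K a) : f ∈ toricIdeal K a := by
  rw [mem_toricIdeal, map_mul, pureBinomial, map_sub, toricHom_monomial, toricHom_monomial] at hf
  exact mem_toricIdeal.2 (single_sub_single_mul_eq_zero huv hf)

end ToricIdeal

/-! ### The height of a toric ideal is the rank of its lattice. -/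

section Height

variable {G : Type*} [AddCommGroup G] {ι : Type*}

/-- The integer vector `u - v`. -/
def expDiff (u v : ι →₀ ℕ) : ι → ℤ := fun i => (u i : ℤ) - v i

/-- The positive part of an integer vector. -/
noncomputable def posPart' [Finite ι] (α : ι → ℤ) : ι →₀ ℕ :=
  Finsupp.equivFunOnFinite.symm fun i => (α i).toNat

lemma posPart'_apply [Finite ι] (α : ι → ℤ) (i : ι) : posPart' α i = (α i).toNat := rfl

lemma expDiff_posPart' [Finite ι] (α : ι → ℤ) : expDiff (posPart' α) (posPart' (-α)) = α := by
  funext i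
  simp only [expDiff, posPart'_apply, Pi.neg_apply]
  omega


section

variable (K : Type*) [Field K]

lemma toricIdeal_le_ker_eval_one (a : ι → G) :
    toricIdeal K a ≤ RingHom.ker (MvPolynomial.eval fun _ : ι => (1 : K)) :=
  toricIdeal_le fun u v _ => by
    simp [RingHom.mem_ker, pureBinomial, MvPolynomial.eval_monomial, Finsupp.prod]

lemma toricIdeal_ne_top (a : ι → G) : toricIdeal K a ≠ ⊤ := fun h =>
  RingHom.ker_ne_top _ (top_le_iff.1 (h ▸ toricIdeal_le_ker_eval_one K a))

/-- Elements of a minimal prime are zero divisors modulo the ideal, whereas monomials become units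
in the group algebra. -/
lemma X_notMem_of_mem_minimalPrimes {a : ι → G} {P : Ideal (MvPolynomial ι K)}
    (hP : P ∈ (toricIdeal K a).minimalPrimes) (i : ι) : MvPolynomial.X i ∉ P := by
  intro h
  obtain ⟨y, hy, hy'⟩ := Ideal.exists_mul_mem_of_mem_minimalPrimes hP h
  exact hy (monomial_mul_mem_toricIdeal.1 hy')

end

variable [Fintype ι]

/-- The lattice of the integral relations of the family `a`. -/
def relations (a : ι → G) : Submodule ℤ (ι → ℤ) :=
  LinearMap.ker (Fintype.linearCombination ℤ a)

lemma linearCombination_expDiff (a : ι → G) (u v : ι →₀ ℕ) :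
    Fintype.linearCombination ℤ a (expDiff u v) = weight a u - weight a v := by
  simp [Fintype.linearCombination_apply, expDiff, Finsupp.weight_eq_sum, sub_smul,
    Finset.sum_sub_distrib]

lemma expDiff_mem_relations {a : ι → G} {u v : ι →₀ ℕ} :
    expDiff u v ∈ relations a ↔ weight a u = weight a v := by
  rw [relations, LinearMap.mem_ker, linearCombination_expDiff, sub_eq_zero]

lemma linearCombination_mkQ [DecidableEq ι] (D : Submodule ℤ (ι → ℤ)) (α : ι → ℤ) :
    Fintype.linearCombination ℤ (fun i => D.mkQ (Pi.single i 1)) α = D.mkQ α := by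
  rw [Fintype.linearCombination_apply]
  simp_rw [← map_smul]
  rw [← map_sum]
  congr 1
  funext j
  simp [Finset.sum_apply, Pi.single_apply]

variable (K : Type*) [Field K]

/-- A chain of primes is built one vector at a time. The sublattices need not be saturated, so their
toric ideals need not be prime and one passes to minimal primes. The inclusion is strict because the
binomial of the last vector has infinite order modulo the span of the others and is thus a
nonzerodivisor. -/
lemma natCast_le_height_of_linearIndependent {n : ℕ} {v : Fin n → ι → ℤ}
    (hv : LinearIndependent ℤ v) {P : Ideal (MvPolynomial ι K)} (hP : P.IsPrime)
    (hvP : ∀ u w, expDiff u w ∈ Submodule.span ℤ (Set.range v) → pureBinomial K u w ∈ P) :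
    (n : ℕ∞) ≤ P.height := by
  classical
  induction n generalizing P with
  | zero => simp
  | succ n ih =>
    set D := Submodule.span ℤ (Set.range fun i : Fin n => v i.castSucc) with hD
    have hDle : D ≤ Submodule.span ℤ (Set.range v) :=
      Submodule.span_mono (Set.range_subset_iff.2 fun i => ⟨i.castSucc, rfl⟩)
    set q : ι → (ι → ℤ) ⧸ D := fun i => D.mkQ (Pi.single i 1) with hq
    have hqw : ∀ u w : ι →₀ ℕ, weight q u - weight q w = D.mkQ (expDiff u w) := fun u w => by
      rw [← linearCombination_expDiff, hq, linearCombination_mkQ]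
    have hqD : ∀ u w : ι →₀ ℕ, weight q u = weight q w ↔ expDiff u w ∈ D := fun u w => by
      rw [← sub_eq_zero, hqw]
      exact Submodule.Quotient.mk_eq_zero D
    obtain ⟨P', hP', hP'P⟩ := Ideal.exists_minimalPrimes_le (I := toricIdeal K q) (J := P)
      (toricIdeal_le fun u w huw => hvP u w (hDle ((hqD u w).1 huw)))
    have := hP'.isPrime
    have h1 := ih (hv.comp _ (Fin.castSucc_injective n)) hP'.isPrime fun u w huw =>
      hP'.le (pureBinomial_mem_toricIdeal.2 ((hqD u w).2 huw))
    have hlt : P' < P := by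
      refine lt_of_le_of_ne hP'P fun heq => ?_
      have hmem : pureBinomial K (posPart' (v (Fin.last n))) (posPart' (-v (Fin.last n))) ∈ P' := by
        rw [heq]
        refine hvP _ _ ?_
        rw [expDiff_posPart']
        exact Submodule.subset_span ⟨_, rfl⟩
      obtain ⟨y, hy, hy'⟩ := Ideal.exists_mul_mem_of_mem_minimalPrimes hP' hmem
      refine hy (pureBinomial_mul_mem_toricIdeal (fun k hk => ?_) hy')
      rw [hqw, expDiff_posPart', ← map_nsmul, ← natCast_zsmul] at hk
      have := hv.eq_zero_of_smul_mem_span (Fin.last n) (k : ℤ) (by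
        refine Submodule.span_mono ?_ ((Submodule.Quotient.mk_eq_zero D).1 hk)
        rintro _ ⟨i, rfl⟩
        exact ⟨i.castSucc, by simp [Fin.ext_iff, i.2.ne], rfl⟩)
      exact_mod_cast this
    rw [Nat.cast_succ]
    exact (add_le_add_left h1 1).trans (Ideal.height_add_one_le_of_lt_of_isPrime hlt)

lemma exists_basis_relations (a : ι → G) :
    ∃ v : Fin (Module.finrank ℤ (relations a)) → ι → ℤ, LinearIndependent ℤ v ∧
      Submodule.span ℤ (Set.range v) = relations a := by
  let b := Module.finBasis ℤ (relations a)
  refine ⟨fun i => b i, b.linearIndependent.map' (relations a).subtype (Submodule.ker_subtype _), ?_⟩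
  rw [show (fun i => (b i : ι → ℤ)) = (relations a).subtype ∘ b from rfl, Set.range_comp,
    Submodule.span_image, b.span_eq, Submodule.map_top, Submodule.range_subtype]

/-- The height of a toric ideal is at least the rank of the lattice of relations. -/
lemma finrank_relations_le_height_of_isPrime (a : ι → G) {P : Ideal (MvPolynomial ι K)}
    (hP : P.IsPrime) (haP : toricIdeal K a ≤ P) :
    (Module.finrank ℤ (relations a) : ℕ∞) ≤ P.height := by
  obtain ⟨v, hv, hspan⟩ := exists_basis_relations a
  refine natCast_le_height_of_linearIndependent K hv hP fun u w huw => haP ?_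
  rw [hspan] at huw
  exact pureBinomial_mem_toricIdeal.2 (expDiff_mem_relations.1 huw)

lemma finrank_relations_le_height (a : ι → G) :
    (Module.finrank ℤ (relations a) : ℕ∞) ≤ (toricIdeal K a).height := by
  rw [Ideal.height_eq_inf_minimalPrimes]
  exact le_iInf₂ fun P hP => finrank_relations_le_height_of_isPrime K a hP.isPrime hP.le

/-- A prime ideal that contains no variable and that contains binomials for generators of the
lattice of relations contains the toric ideal. -/
lemma toricIdeal_le_of_isPrime {a : ι → G} {Q : Ideal (MvPolynomial ι K)} (hQ : Q.IsPrime)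
    (hX : ∀ i, MvPolynomial.X i ∉ Q) {s : Set (ι → ℤ)} (hs : relations a ≤ Submodule.span ℤ s)
    (hsQ : ∀ α ∈ s, pureBinomial K (posPart' α) (posPart' (-α)) ∈ Q) : toricIdeal K a ≤ Q := by
  -- In the fraction field of the quotient the variables become units, so membership of binomials in
  -- `Q` is a condition on degrees in the multiplicative group, and the admissible vectors form a
  -- lattice.
  let F := FractionRing (MvPolynomial ι K ⧸ Q)
  let f : MvPolynomial ι K →+* F := (algebraMap _ F).comp (Ideal.Quotient.mk Q)
  have hf : ∀ p, f p = 0 ↔ p ∈ Q := fun p => by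
    rw [← Ideal.Quotient.eq_zero_iff_mem]
    exact IsFractionRing.to_map_eq_zero_iff (R := MvPolynomial ι K ⧸ Q) (K := F)
  let y : ι → Additive Fˣ := fun i => Additive.ofMul (Units.mk0 (f (MvPolynomial.X i))
    fun h => hX i ((hf _).1 h))
  have hy : ∀ u : ι →₀ ℕ, f (MvPolynomial.monomial u 1) = ((weight y u).toMul : Fˣ) := by
    intro u
    induction u using Finsupp.induction_linear with
    | zero => simp
    | add u v hu hv =>
      rw [map_add, toMul_add, Units.val_mul, ← hu, ← hv, ← map_mul, MvPolynomial.monomial_mul,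
        mul_one]
    | single i n =>
      rw [← MvPolynomial.X_pow_eq_monomial, map_pow, Finsupp.weight_single, toMul_nsmul,
        Units.val_pow_eq_pow_val]
      rfl
  have hmem : ∀ u v : ι →₀ ℕ, pureBinomial K u v ∈ Q ↔ weight y u = weight y v := by
    intro u v
    rw [← hf, pureBinomial, map_sub, hy, hy, sub_eq_zero, Units.val_inj]
    exact Additive.toMul.injective.eq_iff
  have hle : relations a ≤ relations y := hs.trans (Submodule.span_le.2 fun α hα => by
    have := (hmem _ _).1 (hsQ α hα)
    rw [← expDiff_mem_relations, expDiff_posPart'] at this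
    exact this)
  exact toricIdeal_le fun u v huv =>
    (hmem u v).2 (expDiff_mem_relations.1 (hle (expDiff_mem_relations.2 huv)))

/-- The height of a toric ideal is at most the rank of the lattice of relations. -/
lemma height_toricIdeal_le (a : ι → G) :
    (toricIdeal K a).height ≤ (Module.finrank ℤ (relations a) : ℕ∞) := by
  obtain ⟨P, hP⟩ := Ideal.nonempty_minimalPrimes (toricIdeal_ne_top K a)
  have := hP.isPrime
  refine (Ideal.height_mono hP.le).trans ?_
  obtain ⟨v, -, hspan⟩ := exists_basis_relations a
  let g : Fin (Module.finrank ℤ (relations a)) → MvPolynomial ι K := fun i =>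
    pureBinomial K (posPart' (v i)) (posPart' (-v i))
  have hg : ∀ i, g i ∈ toricIdeal K a := fun i => pureBinomial_mem_toricIdeal.2 (by
    rw [← expDiff_mem_relations, expDiff_posPart', ← hspan]
    exact Submodule.subset_span ⟨i, rfl⟩)
  -- The binomials of a lattice basis may generate a smaller ideal, but a prime between it and `P`
  -- contains no variable and therefore contains the whole toric ideal. Krull's height theorem then
  -- bounds the height of `P`.
  have hPmin : P ∈ (Ideal.span (Set.range g)).minimalPrimes := by
    refine ⟨⟨hP.isPrime, (Ideal.span_le.2 (Set.range_subset_iff.2 hg)).trans hP.le⟩, ?_⟩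
    rintro Q ⟨hQ, hgQ⟩ hQP
    refine hP.2 ⟨hQ, toricIdeal_le_of_isPrime K hQ
      (fun i hi => X_notMem_of_mem_minimalPrimes K hP i (hQP hi)) hspan.ge ?_⟩ hQP
    rintro _ ⟨i, rfl⟩
    exact hgQ (Ideal.subset_span ⟨i, rfl⟩)
  refine (Ideal.height_le_card_of_mem_minimalPrimes_span (Set.finite_range g) hPmin).trans ?_
  have := Set.ncard_image_le (f := g) (Set.finite_univ)
  rw [Set.image_univ, Set.ncard_univ, Nat.card_fin] at this
  exact_mod_cast this

/-- A toric ideal cannot be generated by fewer elements than the rank of the lattice of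
relations. -/
lemma finrank_relations_le_card {a : ι → G} {ρ : Type*} [Fintype ρ] {f : ρ → MvPolynomial ι K}
    (hf : Ideal.span (Set.range f) = toricIdeal K a) :
    Module.finrank ℤ (relations a) ≤ Fintype.card ρ := by
  obtain ⟨P, hP⟩ := Ideal.nonempty_minimalPrimes (toricIdeal_ne_top K a)
  have h1 := finrank_relations_le_height_of_isPrime K a hP.isPrime hP.le
  rw [← hf] at hP
  have h2 := Ideal.height_le_card_of_mem_minimalPrimes_span (Set.finite_range f) hP
  have h3 := Set.ncard_image_le (f := f) (Set.finite_univ)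
  rw [Set.image_univ, Set.ncard_univ, Nat.card_eq_fintype_card] at h3
  exact (ENat.natCast_le_natCast.1 (h1.trans h2)).trans h3

end Height

/-! ### The grading by the semigroup and Nakayama's lemma. -/

section Nakayama

variable {G : Type*} [AddCommGroup G] {ι : Type*} {a : ι → G}

lemma weight_mem_closure (a : ι → G) (u : ι →₀ ℕ) :
    weight a u ∈ AddSubmonoid.closure (Set.range a) := by
  induction u using Finsupp.induction_linear with
  | zero => rw [map_zero]; exact zero_mem _
  | add u v hu hv => rw [map_add]; exact add_mem hu hv
  | single i n =>
    rw [Finsupp.weight_single]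
    exact nsmul_mem (AddSubmonoid.subset_closure (Set.mem_range_self i)) n

lemma exists_weight_eq {x : G} (hx : x ∈ AddSubmonoid.closure (Set.range a)) :
    ∃ u : ι →₀ ℕ, weight a u = x := by
  induction hx using AddSubmonoid.closure_induction with
  | mem x hx =>
    obtain ⟨i, rfl⟩ := hx
    exact ⟨Finsupp.single i 1, by rw [Finsupp.weight_single, one_smul]⟩
  | zero => exact ⟨0, map_zero _⟩
  | add x y _ _ hx hy =>
    obtain ⟨u, rfl⟩ := hx
    obtain ⟨v, rfl⟩ := hy
    exact ⟨u + v, map_add _ _ _⟩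

lemma eq_zero_of_weight_eq_zero (ha0 : ∀ i, a i ≠ 0)
    (hinv : HasNoInvertibles (AddSubmonoid.closure (Set.range a))) {u : ι →₀ ℕ}
    (hu : weight a u = 0) : u = 0 := by
  by_contra hne
  obtain ⟨i, hi⟩ := Finsupp.ne_iff.1 hne
  have h := Finsupp.weight_sub_single_add (w := a) hi
  rw [hu] at h
  refine ha0 i (hinv _ (AddSubmonoid.subset_closure ⟨i, rfl⟩) ?_)
  rw [← eq_neg_of_add_eq_zero_left h]
  exact weight_mem_closure a _

/-- Comparable exponents of equal degree differ by an exponent of degree zero, hence coincide; by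
Dickson's lemma antichains of exponents are finite. -/
lemma finite_setOf_weight_eq (ha0 : ∀ i, a i ≠ 0)
    (hinv : HasNoInvertibles (AddSubmonoid.closure (Set.range a))) [Finite ι] (g : G) :
    {u : ι →₀ ℕ | weight a u = g}.Finite := by
  refine WellQuasiOrderedLE.finite_of_isAntichain fun u hu v hv huv hle => huv ?_
  obtain ⟨w, rfl⟩ := exists_add_of_le hle
  rw [Set.mem_ofPred_eq] at hu hv
  rw [map_add, hu, add_eq_left] at hv
  rw [eq_zero_of_weight_eq_zero ha0 hinv hv, add_zero]

variable {K : Type*} [Field K]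

lemma weightedHomogeneousComponent_mul {p q : MvPolynomial ι K} {d : G}
    (hq : MvPolynomial.IsWeightedHomogeneous a q d) (g : G) :
    MvPolynomial.weightedHomogeneousComponent a g (p * q) =
      MvPolynomial.weightedHomogeneousComponent a (g - d) p * q := by
  classical
  induction p using MvPolynomial.induction_on' with
  | add p r hp hr => rw [add_mul, map_add, hp, hr, map_add, add_mul]
  | monomial u c =>
    have h1 := MvPolynomial.isWeightedHomogeneous_monomial a u c rfl
    rw [MvPolynomial.weightedHomogeneousComponent_of_mem
        ((MvPolynomial.mem_weightedHomogeneousSubmodule K a _ _).2 (h1.mul hq)),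
      MvPolynomial.weightedHomogeneousComponent_of_mem
        ((MvPolynomial.mem_weightedHomogeneousSubmodule K a _ _).2 h1), ite_mul, zero_mul]
    exact if_congr sub_eq_iff_eq_add.symm rfl rfl

lemma isWeightedHomogeneous_pureBinomial {u v : ι →₀ ℕ} (huv : weight a u = weight a v) :
    MvPolynomial.IsWeightedHomogeneous a (pureBinomial K u v) (weight a u) :=
  MvPolynomial.IsWeightedHomogeneous.sub (MvPolynomial.isWeightedHomogeneous_monomial a u 1 rfl)
    (MvPolynomial.isWeightedHomogeneous_monomial a v 1 huv.symm)

/-- The graded Nakayama lemma for toric ideals. -/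
lemma toricIdeal_le_of_le_sup_mul [Finite ι] (ha0 : ∀ i, a i ≠ 0)
    (hinv : HasNoInvertibles (AddSubmonoid.closure (Set.range a)))
    {s : Set (MvPolynomial ι K)}
    (hs : ∀ p ∈ s, ∃ d, MvPolynomial.IsWeightedHomogeneous a p d)
    (h : toricIdeal K a ≤ Ideal.span s ⊔
      RingHom.ker (MvPolynomial.constantCoeff : MvPolynomial ι K →+* K) * toricIdeal K a) :
    toricIdeal K a ≤ Ideal.span s := by
  classical
  have hcomp : ∀ g, ∀ p ∈ Ideal.span s,
      MvPolynomial.weightedHomogeneousComponent a g p ∈ Ideal.span s := by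
    intro g p hp
    induction hp using Submodule.span_induction generalizing g with
    | mem p hp =>
      obtain ⟨d, hd⟩ := hs p hp
      rw [← one_mul p, weightedHomogeneousComponent_mul hd]
      exact Ideal.mul_mem_left _ _ (Ideal.subset_span hp)
    | zero => rw [map_zero]; exact zero_mem _
    | add p q _ _ hp hq => rw [map_add]; exact add_mem (hp g) (hq g)
    | smul r p _ hp =>
      rw [smul_eq_mul]
      induction r using MvPolynomial.induction_on' with
      | add r r' hr hr' => rw [add_mul, map_add]; exact add_mem hr hr'
      | monomial u c =>
        rw [mul_comm, weightedHomogeneousComponent_mul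
          (MvPolynomial.isWeightedHomogeneous_monomial a u c rfl)]
        exact Ideal.mul_mem_right _ _ (hp _)
  -- Induction on a bound for the total degree of the monomials of weight `g`: pulling out a
  -- variable `X i` passes to weight `g - a i`, whose monomials have smaller total degree.
  have key : ∀ n : ℕ, ∀ g, (∀ u : ι →₀ ℕ, weight a u = g → u.degree < n) →
      ∀ f ∈ toricIdeal K a, MvPolynomial.weightedHomogeneousComponent a g f ∈ Ideal.span s := by
    intro n
    induction n with
    | zero =>
      intro g hg f _
      rw [MvPolynomial.weightedHomogeneousComponent_eq_zero' _ _ fun u _ hu =>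
        absurd (hg u hu) (Nat.not_lt_zero _)]
      exact zero_mem _
    | succ n ih =>
      intro g hg f hf
      obtain ⟨p, hp, q, hq, rfl⟩ := Submodule.mem_sup.1 (h hf)
      rw [map_add]
      refine add_mem (hcomp g p hp) ?_
      clear hf hp
      induction hq using Submodule.mul_induction_on' with
      | add x _ y _ hx hy => rw [map_add]; exact add_mem hx hy
      | mem_mul_mem r hr y hy =>
        have hr' : r ∈ Ideal.span (MvPolynomial.X '' (Set.univ : Set ι)) := by
          rw [MvPolynomial.mem_ideal_span_X_image]
          intro m hm
          by_contra! hm0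
          have : m = 0 := Finsupp.ext fun i => hm0 i trivial
          rw [this, MvPolynomial.mem_support_iff] at hm
          have h0 : MvPolynomial.constantCoeff r = 0 := RingHom.mem_ker.1 hr
          exact hm h0
        clear hr
        induction hr' using Submodule.span_induction generalizing y with
        | mem r hr =>
          obtain ⟨i, -, rfl⟩ := hr
          rw [mul_comm, weightedHomogeneousComponent_mul
            (MvPolynomial.isWeightedHomogeneous_X K a i)]
          refine Ideal.mul_mem_right _ _ (ih _ (fun u hu => ?_) y hy)
          have := hg (u + Finsupp.single i 1) (by
            rw [map_add, hu, Finsupp.weight_single, one_smul, sub_add_cancel])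
          rw [map_add, Finsupp.degree_single] at this
          omega
        | zero => rw [zero_mul, map_zero]; exact zero_mem _
        | add p q _ _ hp hq => rw [add_mul, map_add]; exact add_mem (hp y hy) (hq y hy)
        | smul p r _ hr =>
          rw [smul_eq_mul, mul_comm p r, mul_assoc]
          exact hr _ (Ideal.mul_mem_left _ _ hy)
  refine toricIdeal_le fun u v huv => ?_
  obtain ⟨n, hn⟩ := ((finite_setOf_weight_eq ha0 hinv (weight a u)).image Finsupp.degree).bddAbove
  have := key (n + 1) (weight a u) (fun w hw => Nat.lt_succ_of_le (hn ⟨w, hw, rfl⟩)) _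
    (pureBinomial_mem_toricIdeal.2 huv)
  rwa [MvPolynomial.weightedHomogeneousComponent_of_mem
    ((MvPolynomial.mem_weightedHomogeneousSubmodule K a _ _).2
      (isWeightedHomogeneous_pureBinomial huv)), if_pos rfl] at this

lemma toricIdeal_le_ker_constantCoeff (ha0 : ∀ i, a i ≠ 0)
    (hinv : HasNoInvertibles (AddSubmonoid.closure (Set.range a))) :
    toricIdeal K a ≤ RingHom.ker (MvPolynomial.constantCoeff : MvPolynomial ι K →+* K) := by
  classical
  refine toricIdeal_le fun u v huv => ?_
  have : u = 0 ↔ v = 0 := by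
    constructor
    · rintro rfl
      exact eq_zero_of_weight_eq_zero ha0 hinv (by rw [← huv, map_zero])
    · rintro rfl
      exact eq_zero_of_weight_eq_zero ha0 hinv (by rw [huv, map_zero])
  rw [RingHom.mem_ker, pureBinomial, map_sub, MvPolynomial.constantCoeff_monomial,
    MvPolynomial.constantCoeff_monomial, sub_eq_zero]
  exact if_congr this rfl rfl

end Nakayama

/-! ### Ideals with a bounded number of generators. -/

section Generators

/-- The ideal `I` is generated by at most `n` elements. -/
def GeneratedBy {R : Type*} [CommRing R] (n : ℕ) (I : Ideal R) : Prop :=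
  ∃ s : Finset R, s.card ≤ n ∧ Ideal.span (s : Set R) = I

lemma GeneratedBy.mono {R : Type*} [CommRing R] {m n : ℕ} {I : Ideal R} (h : GeneratedBy m I)
    (hmn : m ≤ n) : GeneratedBy n I :=
  h.imp fun _ hs => ⟨hs.1.trans hmn, hs.2⟩

lemma GeneratedBy.sup {R : Type*} [CommRing R] {m n : ℕ} {I J : Ideal R} (hI : GeneratedBy m I)
    (hJ : GeneratedBy n J) : GeneratedBy (m + n) (I ⊔ J) := by
  classical
  obtain ⟨s, hs, rfl⟩ := hI
  obtain ⟨t, ht, rfl⟩ := hJ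
  refine ⟨s ∪ t, (Finset.card_union_le _ _).trans (add_le_add hs ht), ?_⟩
  rw [Finset.coe_union, Ideal.span_union]

lemma GeneratedBy.map {R S : Type*} [CommRing R] [CommRing S] {n : ℕ} {I : Ideal R}
    (hI : GeneratedBy n I) (f : R →+* S) : GeneratedBy n (I.map f) := by
  classical
  obtain ⟨s, hs, rfl⟩ := hI
  exact ⟨s.image f, Finset.card_image_le.trans hs, by rw [Finset.coe_image, Ideal.map_span]⟩

lemma GeneratedBy.span_range {R ρ : Type*} [CommRing R] [Fintype ρ] (f : ρ → R) :
    GeneratedBy (Fintype.card ρ) (Ideal.span (Set.range f)) := by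
  classical
  exact ⟨Finset.univ.image f, Finset.card_image_le, by simp⟩

end Generators

/-! ### Adding and removing redundant semigroup generators. -/

section Elimination

variable {G : Type*} [AddCommGroup G] {ι κ : Type*} (K : Type*) [Field K]

/-- The substitution `y_k ↦ x^{w k}`. -/
noncomputable def substMonomials (w : κ → ι →₀ ℕ) :
    MvPolynomial (ι ⊕ κ) K →ₐ[K] MvPolynomial ι K :=
  MvPolynomial.aeval (Sum.elim MvPolynomial.X fun k => MvPolynomial.monomial (w k) 1)

variable {K}

lemma substMonomials_X_inl (w : κ → ι →₀ ℕ) (i : ι) :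
    substMonomials K w (MvPolynomial.X (Sum.inl i)) = MvPolynomial.X i := by
  simp [substMonomials]

lemma substMonomials_X_inr (w : κ → ι →₀ ℕ) (k : κ) :
    substMonomials K w (MvPolynomial.X (Sum.inr k)) = MvPolynomial.monomial (w k) 1 := by
  simp [substMonomials]

lemma substMonomials_rename (w : κ → ι →₀ ℕ) (f : MvPolynomial ι K) :
    substMonomials K w (MvPolynomial.rename Sum.inl f) = f := by
  rw [substMonomials, MvPolynomial.aeval_rename]
  exact MvPolynomial.aeval_X_left_apply f

variable {a : ι → G} {b : κ → G} {w : κ → ι →₀ ℕ}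

lemma toricHom_substMonomials (hw : ∀ k, weight a (w k) = b k) (f : MvPolynomial (ι ⊕ κ) K) :
    toricHom K a (substMonomials K w f) = toricHom K (Sum.elim a b) f := by
  refine DFunLike.congr_fun (f := (toricHom K a).comp (substMonomials K w)) ?_ f
  refine MvPolynomial.algHom_ext fun j => ?_
  rcases j with i | k
  · rw [AlgHom.comp_apply, substMonomials_X_inl, toricHom_X, toricHom_X, Sum.elim_inl]
  · rw [AlgHom.comp_apply, substMonomials_X_inr, toricHom_X, toricHom_monomial, hw, Sum.elim_inr]

lemma substMonomials_mem_toricIdeal (hw : ∀ k, weight a (w k) = b k)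
    {f : MvPolynomial (ι ⊕ κ) K} :
    substMonomials K w f ∈ toricIdeal K a ↔ f ∈ toricIdeal K (Sum.elim a b) := by
  rw [mem_toricIdeal, mem_toricIdeal, toricHom_substMonomials hw]

/-- Modulo the elements y_k - x^{w k}, each polynomial equals its substitution, which lies in the
toric ideal of `a` exactly when the polynomial lies in the larger one. -/
lemma toricIdeal_sumElim (hw : ∀ k, weight a (w k) = b k) :
    toricIdeal K (Sum.elim a b) =
      (toricIdeal K a).map (MvPolynomial.rename Sum.inl : MvPolynomial ι K →ₐ[K] _).toRingHom ⊔
        Ideal.span (Set.range fun k => MvPolynomial.X (Sum.inr k) -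
          MvPolynomial.rename Sum.inl (MvPolynomial.monomial (w k) 1)) := by
  set J := (toricIdeal K a).map
      (MvPolynomial.rename Sum.inl : MvPolynomial ι K →ₐ[K] MvPolynomial (ι ⊕ κ) K).toRingHom ⊔
        Ideal.span (Set.range fun k => MvPolynomial.X (Sum.inr k) -
          MvPolynomial.rename Sum.inl (MvPolynomial.monomial (w k) 1)) with hJ
  refine le_antisymm (fun f hf => ?_) (sup_le (Ideal.map_le_iff_le_comap.2 fun f hf => ?_)
    (Ideal.span_le.2 ?_))
  · have h1 : MvPolynomial.rename Sum.inl (substMonomials K w f) ∈ J :=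
      Ideal.mem_sup_left (Ideal.mem_map_of_mem _ ((substMonomials_mem_toricIdeal hw).2 hf))
    have h2 : ∀ f, Ideal.Quotient.mkₐ K J (MvPolynomial.rename Sum.inl (substMonomials K w f)) =
        Ideal.Quotient.mkₐ K J f := by
      intro f
      refine DFunLike.congr_fun (f := ((Ideal.Quotient.mkₐ K J).comp
        (MvPolynomial.rename Sum.inl)).comp (substMonomials K w)) ?_ f
      refine MvPolynomial.algHom_ext fun j => ?_
      rcases j with i | k
      · rw [AlgHom.comp_apply, AlgHom.comp_apply, substMonomials_X_inl, MvPolynomial.rename_X]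
      · rw [AlgHom.comp_apply, AlgHom.comp_apply, substMonomials_X_inr, eq_comm]
        exact Ideal.Quotient.eq.2 (Ideal.mem_sup_right (Ideal.subset_span ⟨k, rfl⟩))
    have h3 := h2 f
    rw [Ideal.Quotient.mkₐ_eq_mk, Ideal.Quotient.eq_zero_iff_mem.2 h1] at h3
    exact Ideal.Quotient.eq_zero_iff_mem.1 h3.symm
  · refine (substMonomials_mem_toricIdeal hw).1 ?_
    have := substMonomials_rename w f
    exact this.symm ▸ hf
  · rintro _ ⟨k, rfl⟩
    refine (substMonomials_mem_toricIdeal hw).1 ?_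
    rw [map_sub, substMonomials_X_inr, substMonomials_rename, sub_self]
    exact zero_mem _

/-- Adding redundant generators adds as many generators of the toric ideal. -/
lemma GeneratedBy.toricIdeal_sumElim [Fintype κ] {n : ℕ} (h : GeneratedBy n (toricIdeal K a))
    (hb : ∀ k, b k ∈ AddSubmonoid.closure (Set.range a)) :
    GeneratedBy (n + Fintype.card κ) (toricIdeal K (Sum.elim a b)) := by
  choose w hw using fun k => exists_weight_eq (hb k)
  rw [_root_.toricIdeal_sumElim hw]
  exact (h.map _).sup (GeneratedBy.span_range _)

lemma pderiv_rename_inl (k : κ) (f : MvPolynomial ι K) :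
    MvPolynomial.pderiv (Sum.inr k) (MvPolynomial.rename Sum.inl f) = 0 := by
  induction f using MvPolynomial.induction_on with
  | C c => simp
  | add p q hp hq => simp [hp, hq]
  | mul_X p i hp => simp [hp]

/-- Removing redundant generators removes at least as many generators of the toric ideal; the
remaining ones can be chosen to be binomials. -/
lemma exists_pureBinomial_generators [Fintype ι] [Fintype κ] (ha0 : ∀ i, a i ≠ 0)
    (hinv : HasNoInvertibles (AddSubmonoid.closure (Set.range a)))
    (hb : ∀ k, b k ∈ AddSubmonoid.closure (Set.range a)) {n : ℕ}
    (h : GeneratedBy n (toricIdeal K (Sum.elim a b))) :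
    ∃ (m : ℕ) (u v : Fin m → ι →₀ ℕ), m + Fintype.card κ ≤ n ∧
      (∀ t, weight a (u t) = weight a (v t)) ∧ (∀ t, u t ≠ v t) ∧
      Ideal.span (Set.range fun t => pureBinomial K (u t) (v t)) = toricIdeal K a := by
  classical
  choose w hw using fun k => exists_weight_eq (hb k)
  obtain ⟨s, hsn, hs⟩ := h
  set M := RingHom.ker (MvPolynomial.constantCoeff : MvPolynomial ι K →+* K) with hM
  set N := M * toricIdeal K a with hN
  let π : MvPolynomial ι K →ₗ[K] MvPolynomial ι K ⧸ N := (Ideal.Quotient.mkₐ K N).toLinearMap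
  have hπ : ∀ f, π f = 0 ↔ f ∈ N := fun f => Ideal.Quotient.eq_zero_iff_mem
  -- The constant term is taken after the substitution, so that a redundant generator equal to zero
  -- causes no trouble: its variable goes to 1 rather than 0.
  let ε : MvPolynomial (ι ⊕ κ) K →ₐ[K] K :=
    (MvPolynomial.aeval (fun _ : ι => (0 : K))).comp (substMonomials K w)
  have hε : ∀ f, ε f = MvPolynomial.constantCoeff (substMonomials K w f) := fun f =>
    MvPolynomial.aeval_zero' _
  have hε0 : ∀ f ∈ toricIdeal K (Sum.elim a b), ε f = 0 := fun f hf => by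
    rw [hε]
    exact toricIdeal_le_ker_constantCoeff ha0 hinv ((substMonomials_mem_toricIdeal hw).2 hf)
  -- The class modulo `M * toricIdeal K a` counts generators for `a`; the derivatives in the
  -- redundant variables detect the relations y_k - x^{w k}. On the larger toric ideal, `Ψ` is
  -- linear over polynomials acting through `ε`, so its image is spanned by at most `n` vectors.
  let Ψ : MvPolynomial (ι ⊕ κ) K →ₗ[K] (MvPolynomial ι K ⧸ N) × (κ → K) :=
    (π.comp (substMonomials K w).toLinearMap).prod
      (LinearMap.pi fun k => ε.toLinearMap.comp (MvPolynomial.pderiv (Sum.inr k)).toLinearMap)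
  have hΨ : ∀ f, Ψ f = (π (substMonomials K w f), fun k => ε (MvPolynomial.pderiv (Sum.inr k) f)) :=
    fun f => rfl
  have hΨmul : ∀ g, ∀ f ∈ toricIdeal K (Sum.elim a b), Ψ (g * f) = ε g • Ψ f := by
    intro g f hf
    rw [hΨ, hΨ, Prod.smul_mk]
    refine Prod.ext_iff.2 ⟨?_, ?_⟩
    · rw [← sub_eq_zero, ← map_smul, ← map_sub, hπ, map_mul, Algebra.smul_def, ← sub_mul]
      refine Ideal.mul_mem_mul ?_ ((substMonomials_mem_toricIdeal hw).2 hf)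
      rw [hM, RingHom.mem_ker, map_sub, hε, MvPolynomial.algebraMap_eq,
        MvPolynomial.constantCoeff_C, sub_self]
    · funext k
      simp [Derivation.leibniz, hε0 f hf]
  have hspan : ∀ f ∈ toricIdeal K (Sum.elim a b), Ψ f ∈ Submodule.span K (Ψ '' (s : Set _)) := by
    intro f hf
    rw [← hs] at hf
    induction hf using Submodule.span_induction with
    | mem f hf => exact Submodule.subset_span ⟨f, hf, rfl⟩
    | zero => rw [map_zero]; exact zero_mem _
    | add p q _ _ hp hq => rw [map_add]; exact add_mem hp hq
    | smul g f hf ih =>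
      rw [smul_eq_mul, hΨmul g f (hs ▸ hf)]
      exact Submodule.smul_mem _ _ ih
  -- Binomials span the toric ideal, so a basis of its classes can be taken among theirs. Together
  -- with the basis vectors of the second factor it is independent in the image of `Ψ`, which bounds
  -- its size.
  obtain ⟨B, hB, hBspan, hBlin⟩ := exists_linearIndependent K
    (π '' {f | ∃ u v : ι →₀ ℕ, weight a u = weight a v ∧ f = pureBinomial K u v})
  have hlin : LinearIndependent K (Sum.elim
      (LinearMap.inl K (MvPolynomial ι K ⧸ N) (κ → K) ∘ (Subtype.val : B → _))
      (LinearMap.inr K (MvPolynomial ι K ⧸ N) (κ → K) ∘ Pi.basisFun K κ)) :=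
    linearIndependent_inl_union_inr' hBlin (Pi.basisFun K κ).linearIndependent
  have hrange : Set.range (Sum.elim
      (LinearMap.inl K (MvPolynomial ι K ⧸ N) (κ → K) ∘ (Subtype.val : B → _))
      (LinearMap.inr K (MvPolynomial ι K ⧸ N) (κ → K) ∘ Pi.basisFun K κ)) ⊆
      Submodule.span K (Ψ '' (s : Set _)) := by
    rintro _ ⟨x | k, rfl⟩
    · obtain ⟨_, ⟨u, v, huv, rfl⟩, hx⟩ := hB x.2
      have hmem : MvPolynomial.rename Sum.inl (pureBinomial K u v) ∈
          toricIdeal K (Sum.elim a b) := by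
        rw [← substMonomials_mem_toricIdeal hw, substMonomials_rename]
        exact pureBinomial_mem_toricIdeal.2 huv
      refine Set.mem_of_eq_of_mem ?_ (hspan _ hmem)
      rw [hΨ, substMonomials_rename, hx]
      refine Prod.ext_iff.2 ⟨rfl, ?_⟩
      funext k
      simp [pderiv_rename_inl]
    · have hmem : MvPolynomial.X (Sum.inr k) - MvPolynomial.rename Sum.inl
          (MvPolynomial.monomial (w k) 1) ∈ toricIdeal K (Sum.elim a b) := by
        rw [← substMonomials_mem_toricIdeal hw, map_sub, substMonomials_X_inr,
          substMonomials_rename, sub_self]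
        exact zero_mem _
      refine Set.mem_of_eq_of_mem ?_ (hspan _ hmem)
      rw [hΨ, map_sub, substMonomials_X_inr, substMonomials_rename, sub_self, map_zero]
      refine Prod.ext_iff.2 ⟨rfl, ?_⟩
      funext l
      simp only [Sum.elim_inr, Function.comp_apply, LinearMap.inr_apply, Pi.basisFun_apply, map_sub,
        pderiv_rename_inl, MvPolynomial.pderiv_X, sub_zero, Pi.single_apply, Sum.inr.injEq]
      by_cases hlk : l = k
      · rw [if_pos hlk, if_pos hlk.symm, map_one]
      · rw [if_neg hlk, if_neg (Ne.symm hlk), map_zero]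
  have hfin := hlin.finite_of_le_span_finite _ _ hrange
  have hBfin : Finite B := Finite.of_injective (Sum.inl : B → B ⊕ κ) Sum.inl_injective
  have := Fintype.ofFinite B
  have := Fintype.ofFinite (Ψ '' (s : Set _))
  have hcard := linearIndependent_le_span' _ hlin _ hrange
  rw [Cardinal.mk_fintype, Nat.cast_le, Fintype.card_sum, ← Nat.card_eq_fintype_card (α := Ψ '' _)]
    at hcard
  have hcard' : Nat.card (Ψ '' (s : Set (MvPolynomial (ι ⊕ κ) K))) ≤ s.card := by
    rw [Nat.card_coe_set_eq]
    exact (Set.ncard_image_le s.finite_toSet).trans_eq (Set.ncard_coe_finset s)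
  have hB' : ∀ x : B, ∃ u v : ι →₀ ℕ, weight a u = weight a v ∧ π (pureBinomial K u v) = x := by
    intro x
    obtain ⟨_, ⟨u, v, huv, rfl⟩, hx⟩ := hB x.2
    exact ⟨u, v, huv, hx⟩
  choose u v huv hp using hB'
  let e := (Fintype.equivFin B).symm
  refine ⟨Fintype.card B, fun t => u (e t), fun t => v (e t), hcard.trans (hcard'.trans hsn),
    fun t => huv (e t), fun t ht => ?_, le_antisymm ?_ ?_⟩
  · have h0 : ((e t : B) : MvPolynomial ι K ⧸ N) = 0 := by
      rw [← hp (e t), show u (e t) = v (e t) from ht, pureBinomial, sub_self, map_zero]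
    exact hBlin.ne_zero (e t) h0
  · refine Ideal.span_le.2 (Set.range_subset_iff.2 fun t => ?_)
    exact pureBinomial_mem_toricIdeal.2 (huv (e t))
  · refine toricIdeal_le_of_le_sup_mul ha0 hinv ?_ fun f hf => ?_
    · rintro _ ⟨t, rfl⟩
      exact ⟨_, isWeightedHomogeneous_pureBinomial (huv (e t))⟩
    · set J := Ideal.span (Set.range fun t => pureBinomial K (u (e t)) (v (e t)))
      have h1 : π f ∈ Submodule.span K B := by
        refine mem_of_mem_toricIdeal (D := (Submodule.span K B).comap π) (fun u v huv => ?_) hf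
        rw [Submodule.mem_comap, hBspan]
        exact Submodule.subset_span ⟨_, ⟨u, v, huv, rfl⟩, rfl⟩
      have h2 : Submodule.span K B ≤ (J.restrictScalars K).map π := by
        refine Submodule.span_le.2 fun x hx =>
          ⟨pureBinomial K (u ⟨x, hx⟩) (v ⟨x, hx⟩), ?_, hp ⟨x, hx⟩⟩
        refine Ideal.subset_span ⟨e.symm ⟨x, hx⟩, ?_⟩
        simp only [Equiv.apply_symm_apply]
      obtain ⟨g, hg, hgf⟩ := h2 h1
      rw [← sub_add_cancel f g, add_comm]
      refine Submodule.add_mem_sup hg ((hπ _).1 ?_)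
      rw [map_sub, hgf, sub_self]

end Elimination

/-! ### Ranks of lattices of relations. -/

section Rank

variable {G : Type*} [AddCommGroup G] {ι κ : Type*}

lemma finrank_relations_add_finrank_span [Fintype ι] (a : ι → G) :
    Module.finrank ℤ (relations a) + Module.finrank ℤ (Submodule.span ℤ (Set.range a)) =
      Fintype.card ι := by
  have h := Submodule.finrank_quotient_add_finrank (relations a)
  have h1 : Module.finrank ℤ ((ι → ℤ) ⧸ relations a) =
      Module.finrank ℤ (Fintype.linearCombination ℤ a).range :=
    (Fintype.linearCombination ℤ a).quotKerEquivRange.finrank_eq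
  rw [h1, Fintype.range_linearCombination, Module.finrank_pi] at h
  rw [add_comm, h]

lemma span_range_eq_of_closure_eq {a : ι → G} {b : κ → G}
    (h : AddSubmonoid.closure (Set.range a) = AddSubmonoid.closure (Set.range b)) :
    Submodule.span ℤ (Set.range a) = Submodule.span ℤ (Set.range b) := by
  have key : ∀ s t : Set G, AddSubmonoid.closure s ≤ AddSubmonoid.closure t →
      Submodule.span ℤ s ≤ Submodule.span ℤ t := by
    intro s t hst
    refine Submodule.span_le.2 fun x hx => ?_
    have h1 : AddSubmonoid.closure t ≤ (Submodule.span ℤ t).toAddSubmonoid :=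
      AddSubmonoid.closure_le.2 Submodule.subset_span
    exact h1 (hst (AddSubmonoid.subset_closure hx))
  exact le_antisymm (key _ _ h.le) (key _ _ h.ge)

lemma closure_range_sumElim_of_mem {a : ι → G} {b : κ → G}
    (hb : ∀ k, b k ∈ AddSubmonoid.closure (Set.range a)) :
    AddSubmonoid.closure (Set.range (Sum.elim a b)) = AddSubmonoid.closure (Set.range a) := by
  rw [Set.Sum.elim_range, AddSubmonoid.closure_union, sup_eq_left, AddSubmonoid.closure_le]
  exact Set.range_subset_iff.2 hb

lemma closure_range_ne_zero (a : ι → G) :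
    AddSubmonoid.closure (Set.range fun i : {i // a i ≠ 0} => a i) =
      AddSubmonoid.closure (Set.range a) := by
  refine le_antisymm (AddSubmonoid.closure_mono ?_) (AddSubmonoid.closure_le.2 ?_)
  · rintro _ ⟨i, rfl⟩
    exact ⟨i, rfl⟩
  · rintro _ ⟨i, rfl⟩
    by_cases hi : a i = 0
    · rw [hi]
      exact zero_mem _
    · exact AddSubmonoid.subset_closure ⟨⟨i, hi⟩, rfl⟩

end Rank

/-! ### Having as few generators as the rank is a property of the semigroup. -/

section Good

variable (K : Type*) [Field K] {G : Type*} [AddCommGroup G] {ι κ : Type*}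

/-- The toric ideal of `a` is generated by as many elements as the rank of the lattice of
relations. -/
def HasFewGenerators [Fintype ι] (a : ι → G) : Prop :=
  GeneratedBy (Module.finrank ℤ (relations a)) (toricIdeal K a)

/-- The toric ideal of `a` is generated by as many binomials as the rank of the lattice of
relations. -/
def HasFewBinomialGenerators [Fintype ι] (a : ι → G) : Prop :=
  ∃ (m : ℕ) (u v : Fin m → ι →₀ ℕ), m ≤ Module.finrank ℤ (relations a) ∧
    (∀ t, weight a (u t) = weight a (v t)) ∧ (∀ t, u t ≠ v t) ∧
    Ideal.span (Set.range fun t => pureBinomial K (u t) (v t)) = toricIdeal K a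

variable {K}

lemma HasFewBinomialGenerators.hasFewGenerators [Fintype ι] {a : ι → G}
    (h : HasFewBinomialGenerators K a) : HasFewGenerators K a := by
  obtain ⟨m, u, v, hm, -, -, hs⟩ := h
  rw [HasFewGenerators, ← hs]
  exact (GeneratedBy.span_range _).mono (by rwa [Fintype.card_fin])

lemma GeneratedBy.toricIdeal_comp_equiv {a : ι → G} {n : ℕ} (h : GeneratedBy n (toricIdeal K a))
    (e : κ ≃ ι) : GeneratedBy n (toricIdeal K (a ∘ e)) := by
  have hcomp : ∀ f, toricHom K (a ∘ e) (MvPolynomial.rename e.symm f) = toricHom K a f := by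
    intro f
    rw [toricHom, MvPolynomial.aeval_rename, toricHom]
    congr 2
    funext i
    simp
  have heq : toricIdeal K (a ∘ e) =
      (toricIdeal K a).map (MvPolynomial.renameEquiv K e.symm).toRingEquiv.toRingHom := by
    refine le_antisymm (fun f hf => ?_) (Ideal.map_le_iff_le_comap.2 fun f hf => ?_)
    · rw [← (MvPolynomial.renameEquiv K e.symm).apply_symm_apply f] at hf ⊢
      refine Ideal.mem_map_of_mem _ ?_
      rw [mem_toricIdeal] at hf ⊢
      rw [← hcomp]
      exact hf
    · rw [Ideal.mem_comap, mem_toricIdeal]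
      exact (hcomp f).trans (mem_toricIdeal.1 hf)
  rw [heq]
  exact h.map _

variable [Fintype ι] [Fintype κ]

lemma HasFewGenerators.comp_equiv {a : ι → G} (h : HasFewGenerators K a) (e : κ ≃ ι) :
    HasFewGenerators K (a ∘ e) := by
  refine (GeneratedBy.toricIdeal_comp_equiv h e).mono (le_of_eq ?_)
  have h1 := finrank_relations_add_finrank_span a
  have h2 := finrank_relations_add_finrank_span (a ∘ e)
  rw [EquivLike.range_comp, Fintype.card_congr e] at h2
  omega

lemma HasFewGenerators.sumElim {a : ι → G} {b : κ → G} (h : HasFewGenerators K a)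
    (hb : ∀ k, b k ∈ AddSubmonoid.closure (Set.range a)) :
    HasFewGenerators K (Sum.elim a b) := by
  refine (GeneratedBy.toricIdeal_sumElim h hb).mono (le_of_eq ?_)
  have h1 := finrank_relations_add_finrank_span a
  have h2 := finrank_relations_add_finrank_span (Sum.elim a b)
  rw [span_range_eq_of_closure_eq (closure_range_sumElim_of_mem hb), Fintype.card_sum] at h2
  omega

/-- Having few generators only depends on the semigroup and not on its generators. -/
lemma HasFewGenerators.hasFewBinomialGenerators {a : ι → G} {b : κ → G}
    (hb : HasFewGenerators K b) (ha0 : ∀ i, a i ≠ 0)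
    (hinv : HasNoInvertibles (AddSubmonoid.closure (Set.range a)))
    (hab : AddSubmonoid.closure (Set.range a) = AddSubmonoid.closure (Set.range b)) :
    HasFewBinomialGenerators K a := by
  -- The two families are compared through their union: `a` is redundant next to `b`, and `b` next
  -- to `a`. Each redundant generator changes the rank by one and the number of ideal generators
  -- accordingly.
  have h1 := hb.sumElim (b := a) fun i => hab ▸ AddSubmonoid.subset_closure (Set.mem_range_self i)
  have h2 := h1.comp_equiv (Equiv.sumComm ι κ)
  have h3 : Sum.elim b a ∘ Equiv.sumComm ι κ = Sum.elim a b := by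
    funext x
    rcases x with i | k <;> rfl
  rw [h3] at h2
  have hmem : ∀ k, b k ∈ AddSubmonoid.closure (Set.range a) := fun k =>
    hab ▸ AddSubmonoid.subset_closure (Set.mem_range_self k)
  obtain ⟨m, u, v, hm, huv, hne, hs⟩ := exists_pureBinomial_generators ha0 hinv hmem h2
  refine ⟨m, u, v, ?_, huv, hne, hs⟩
  have h4 := finrank_relations_add_finrank_span a
  have h5 := finrank_relations_add_finrank_span (Sum.elim a b)
  rw [span_range_eq_of_closure_eq (closure_range_sumElim_of_mem hmem), Fintype.card_sum] at h5
  omega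

/-- Nakayama requires nonzero generators, so the zero entries of `a` are first left out and then put
back as redundant generators. -/
lemma HasFewGenerators.of_closure_eq {a : ι → G} {b : κ → G} (hb : HasFewGenerators K b)
    (hinv : HasNoInvertibles (AddSubmonoid.closure (Set.range a)))
    (hab : AddSubmonoid.closure (Set.range a) = AddSubmonoid.closure (Set.range b)) :
    HasFewGenerators K a := by
  classical
  have h1 := (hb.hasFewBinomialGenerators (a := fun i : {i // a i ≠ 0} => a i) (fun i => i.2)
    (by rwa [closure_range_ne_zero]) (by rwa [closure_range_ne_zero])).hasFewGenerators
  have h2 := h1.sumElim (b := fun i : {i // ¬ a i ≠ 0} => a i) fun i => by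
    rw [not_not.1 i.2]
    exact zero_mem _
  have h3 := h2.comp_equiv (Equiv.sumCompl fun i => a i ≠ 0).symm
  convert h3 using 1
  funext i
  by_cases hi : a i ≠ 0
  · rw [Function.comp_apply, Equiv.sumCompl_symm_apply_of_pos (p := fun i => a i ≠ 0) hi,
      Sum.elim_inl]
  · rw [Function.comp_apply, Equiv.sumCompl_symm_apply_of_neg (p := fun i => a i ≠ 0) hi,
      Sum.elim_inr]

end Good

/-! ### Gluing preserves the minimal number of generators. -/

section Gluing

variable {K : Type*} [Field K] {G : Type*} [AddCommGroup G] {ι κ : Type*} {a : ι → G} {b : κ → G}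

lemma eq_zero_of_nsmul_eq_zero {S : AddSubmonoid G} (hS : HasNoInvertibles S) {c : G} (hc : c ∈ S)
    (hc0 : c ≠ 0) {n : ℕ} (hn : n • c = 0) : n = 0 := by
  by_contra h
  obtain ⟨k, rfl⟩ := Nat.exists_eq_succ_of_ne_zero h
  rw [Nat.succ_eq_add_one, succ_nsmul] at hn
  refine hc0 (hS c hc ?_)
  rw [← eq_neg_of_add_eq_zero_left hn]
  exact nsmul_mem hc k

lemma exists_eq_mapDomain_add (u : ι ⊕ κ →₀ ℕ) :
    ∃ (u₁ : ι →₀ ℕ) (u₂ : κ →₀ ℕ), u = u₁.mapDomain Sum.inl + u₂.mapDomain Sum.inr := by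
  induction u using Finsupp.induction_linear with
  | zero => exact ⟨0, 0, by simp⟩
  | add u v hu hv =>
    obtain ⟨u₁, u₂, rfl⟩ := hu
    obtain ⟨v₁, v₂, rfl⟩ := hv
    exact ⟨u₁ + v₁, u₂ + v₂, by rw [Finsupp.mapDomain_add, Finsupp.mapDomain_add]; abel⟩
  | single i n =>
    rcases i with i | k
    · exact ⟨Finsupp.single i n, 0, by simp⟩
    · exact ⟨0, Finsupp.single k n, by simp⟩

lemma weight_mapDomain {ι' : Type*} (a : ι' → G) (f : ι → ι') (u : ι →₀ ℕ) :
    weight a (u.mapDomain f) = weight (a ∘ f) u := by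
  induction u using Finsupp.induction_linear with
  | zero => simp
  | add u v hu hv => rw [Finsupp.mapDomain_add, map_add, map_add, hu, hv]
  | single i n => simp [Finsupp.weight_single]

lemma weight_mem_addSubgroup_closure (a : ι → G) (u : ι →₀ ℕ) :
    weight a u ∈ AddSubgroup.closure (Set.range a) := by
  have h : AddSubmonoid.closure (Set.range a) ≤
      (AddSubgroup.closure (Set.range a)).toAddSubmonoid :=
    AddSubmonoid.closure_le.2 AddSubgroup.subset_closure
  exact h (weight_mem_closure a u)

/-- If x^{u₁} y^{u₂} and x^{v₁} y^{v₂} have the same degree, the difference of the x-degrees lies in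
both groups and is a multiple of c. Thus one monomial becomes the other by moving within each block
and exchanging powers of x^w for powers of y^z. -/
lemma toricIdeal_le_of_gluing {w : ι →₀ ℕ} {z : κ →₀ ℕ} (hwz : weight a w = weight b z)
    (hc : AddSubgroup.closure (Set.range a) ⊓ AddSubgroup.closure (Set.range b) ≤
      AddSubgroup.zmultiples (weight a w)) :
    toricIdeal K (Sum.elim a b) ≤
      (toricIdeal K a).map (MvPolynomial.rename Sum.inl : MvPolynomial ι K →ₐ[K] _).toRingHom ⊔
      (toricIdeal K b).map (MvPolynomial.rename Sum.inr : MvPolynomial κ K →ₐ[K] _).toRingHom ⊔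
      Ideal.span (Set.range fun _ : Unit => MvPolynomial.rename Sum.inl (MvPolynomial.monomial w 1) -
        MvPolynomial.rename Sum.inr (MvPolynomial.monomial z 1)) := by
  set J := (toricIdeal K a).map
      (MvPolynomial.rename Sum.inl : MvPolynomial ι K →ₐ[K] MvPolynomial (ι ⊕ κ) K).toRingHom ⊔
      (toricIdeal K b).map
      (MvPolynomial.rename Sum.inr : MvPolynomial κ K →ₐ[K] MvPolynomial (ι ⊕ κ) K).toRingHom ⊔
      Ideal.span (Set.range fun _ : Unit => MvPolynomial.rename Sum.inl (MvPolynomial.monomial w 1) -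
        MvPolynomial.rename Sum.inr (MvPolynomial.monomial z 1)) with hJ
  let p : (ι →₀ ℕ) → MvPolynomial (ι ⊕ κ) K ⧸ J := fun u =>
    Ideal.Quotient.mk J (MvPolynomial.rename Sum.inl (MvPolynomial.monomial u 1))
  let q : (κ →₀ ℕ) → MvPolynomial (ι ⊕ κ) K ⧸ J := fun u =>
    Ideal.Quotient.mk J (MvPolynomial.rename Sum.inr (MvPolynomial.monomial u 1))
  have hp : ∀ u v, weight a u = weight a v → p u = p v := fun u v huv => by
    refine Ideal.Quotient.eq.2 (Ideal.mem_sup_left (Ideal.mem_sup_left ?_))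
    rw [← map_sub]
    exact Ideal.mem_map_of_mem _ (pureBinomial_mem_toricIdeal.2 huv)
  have hq : ∀ u v, weight b u = weight b v → q u = q v := fun u v huv => by
    refine Ideal.Quotient.eq.2 (Ideal.mem_sup_left (Ideal.mem_sup_right ?_))
    rw [← map_sub]
    exact Ideal.mem_map_of_mem _ (pureBinomial_mem_toricIdeal.2 huv)
  have hpq : p w = q z := Ideal.Quotient.eq.2 (Ideal.mem_sup_right (Ideal.subset_span ⟨(), rfl⟩))
  have hpmul : ∀ u (n : ℕ), p (u + n • w) = p u * p w ^ n := fun u n => by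
    simp only [p]
    rw [← map_pow, ← map_mul, ← map_pow, ← map_mul, MvPolynomial.monomial_pow,
      MvPolynomial.monomial_mul, one_pow, one_mul]
  have hqmul : ∀ u (n : ℕ), q (u + n • z) = q u * q z ^ n := fun u n => by
    simp only [q]
    rw [← map_pow, ← map_mul, ← map_pow, ← map_mul, MvPolynomial.monomial_pow,
      MvPolynomial.monomial_mul, one_pow, one_mul]
  have key : ∀ (u₁ v₁ : ι →₀ ℕ) (u₂ v₂ : κ →₀ ℕ) (n : ℕ),
      weight a u₁ = weight a v₁ + n • weight a w → weight b v₂ = weight b u₂ + n • weight b z →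
      p u₁ * q u₂ = p v₁ * q v₂ := by
    intro u₁ v₁ u₂ v₂ n h1 h2
    rw [hp u₁ (v₁ + n • w) (by rw [map_add, map_nsmul, h1]),
      hq v₂ (u₂ + n • z) (by rw [map_add, map_nsmul, h2]), hpmul, hqmul, hpq]
    ring
  have hmk : ∀ (u₁ : ι →₀ ℕ) (u₂ : κ →₀ ℕ), Ideal.Quotient.mk J
      (MvPolynomial.monomial (u₁.mapDomain Sum.inl + u₂.mapDomain Sum.inr) 1) = p u₁ * q u₂ := by
    intro u₁ u₂
    simp only [p, q]
    rw [← map_mul, MvPolynomial.rename_monomial, MvPolynomial.rename_monomial,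
      MvPolynomial.monomial_mul, one_mul]
  refine toricIdeal_le fun u v huv => ?_
  obtain ⟨u₁, u₂, rfl⟩ := exists_eq_mapDomain_add u
  obtain ⟨v₁, v₂, rfl⟩ := exists_eq_mapDomain_add v
  rw [map_add, map_add, weight_mapDomain, weight_mapDomain, weight_mapDomain, weight_mapDomain,
    Sum.elim_comp_inl, Sum.elim_comp_inr] at huv
  refine Ideal.Quotient.eq.1 ?_
  rw [hmk, hmk]
  have hd : weight a u₁ - weight a v₁ = weight b v₂ - weight b u₂ := by
    rw [sub_eq_sub_iff_add_eq_add, huv, add_comm]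
  obtain ⟨k, hk⟩ := hc (AddSubgroup.mem_inf.2 ⟨sub_mem (weight_mem_addSubgroup_closure a u₁)
    (weight_mem_addSubgroup_closure a v₁), hd ▸ sub_mem (weight_mem_addSubgroup_closure b v₂)
    (weight_mem_addSubgroup_closure b u₂)⟩)
  simp only at hk
  obtain ⟨n, rfl | rfl⟩ := k.eq_nat_or_neg
  · rw [natCast_zsmul] at hk
    refine key u₁ v₁ u₂ v₂ n ?_ ?_
    · rw [hk]; abel
    · rw [← hwz, hk, hd]; abel
  · rw [neg_smul, natCast_zsmul, neg_eq_iff_eq_neg] at hk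
    refine (key v₁ u₁ v₂ u₂ n ?_ ?_).symm
    · rw [hk]; abel
    · rw [← hwz, hk, hd]; abel

variable [Fintype ι] [Fintype κ]

/-- The extra 1 is the rank of the intersection of the two groups, which is infinite cyclic. -/
lemma finrank_relations_sumElim_of_gluing {c : G} (hc : ∀ n : ℕ, n • c = 0 → n = 0)
    (h : AddSubgroup.zmultiples c =
      AddSubgroup.closure (Set.range a) ⊓ AddSubgroup.closure (Set.range b)) :
    Module.finrank ℤ (relations (Sum.elim a b)) =
      Module.finrank ℤ (relations a) + Module.finrank ℤ (relations b) + 1 := by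
  have h1 := finrank_relations_add_finrank_span a
  have h2 := finrank_relations_add_finrank_span b
  have h3 := finrank_relations_add_finrank_span (Sum.elim a b)
  have hinf : Submodule.span ℤ (Set.range a) ⊓ Submodule.span ℤ (Set.range b) =
      Submodule.span ℤ (Set.range fun _ : Unit => c) := by
    apply Submodule.toAddSubgroup_injective
    rw [Set.range_const, Submodule.span_int_eq_addSubgroupClosure,
      ← AddSubgroup.zmultiples_eq_closure, h]
    refine AddSubgroup.ext fun x => ?_
    rw [Submodule.mem_toAddSubgroup, Submodule.mem_inf, AddSubgroup.mem_inf,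
      ← Submodule.span_int_eq_addSubgroupClosure, ← Submodule.span_int_eq_addSubgroupClosure]
    rfl
  have hlin : LinearIndependent ℤ fun _ : Unit => c := by
    rw [Fintype.linearIndependent_iff]
    intro g hg i
    rw [Fintype.sum_unique] at hg
    obtain ⟨n, hn⟩ := (g default).eq_nat_or_neg
    have : n = 0 := hc n (by
      rcases hn with hn | hn
      · rwa [hn, natCast_zsmul] at hg
      · rwa [hn, neg_smul, neg_eq_zero, natCast_zsmul] at hg)
    have h0 : g default = 0 := by simpa [this] using hn
    exact h0
  have h4 := Submodule.rank_sup_add_rank_inf_eq (Submodule.span ℤ (Set.range a))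
    (Submodule.span ℤ (Set.range b))
  have f1 := Module.Finite.span_of_finite ℤ (Set.finite_range a)
  have f2 := Module.Finite.span_of_finite ℤ (Set.finite_range b)
  have f3 := Module.Finite.span_of_finite ℤ (Set.finite_range (Sum.elim a b))
  have f4 := Module.Finite.span_of_finite ℤ (Set.finite_range fun _ : Unit => c)
  rw [hinf, ← Submodule.span_union, ← Set.Sum.elim_range, ← Module.finrank_eq_rank,
    ← Module.finrank_eq_rank, ← Module.finrank_eq_rank, ← Module.finrank_eq_rank,
    finrank_span_eq_card hlin, Fintype.card_unit] at h4
  norm_cast at h4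
  rw [Fintype.card_sum] at h3
  omega

/-- The gluing of two semigroups with few generators of their toric ideals has this property. -/
lemma HasFewGenerators.of_gluing (ha : HasFewGenerators K a) (hb : HasFewGenerators K b)
    (hinv : HasNoInvertibles (AddSubmonoid.closure (Set.range a))) {c : G} (hc0 : c ≠ 0)
    (hca : c ∈ AddSubmonoid.closure (Set.range a)) (hcb : c ∈ AddSubmonoid.closure (Set.range b))
    (h : AddSubgroup.zmultiples c =
      AddSubgroup.closure (Set.range a) ⊓ AddSubgroup.closure (Set.range b)) :
    HasFewGenerators K (Sum.elim a b) := by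
  obtain ⟨w, rfl⟩ := exists_weight_eq hca
  obtain ⟨z, hz⟩ := exists_weight_eq hcb
  rw [HasFewGenerators, finrank_relations_sumElim_of_gluing
    (fun n hn => eq_zero_of_nsmul_eq_zero hinv hca hc0 hn) h]
  have := le_antisymm (toricIdeal_le_of_gluing (K := K) hz.symm h.ge) (sup_le (sup_le
    (Ideal.map_le_iff_le_comap.2 fun f hf => ?_) (Ideal.map_le_iff_le_comap.2 fun f hf => ?_))
    (Ideal.span_le.2 ?_))
  · rw [this]
    exact ((GeneratedBy.map ha _).sup (GeneratedBy.map hb _)).sup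
      (Fintype.card_unit ▸ GeneratedBy.span_range _)
  · rw [Ideal.mem_comap, mem_toricIdeal]
    refine Eq.trans ?_ (mem_toricIdeal.1 hf)
    exact MvPolynomial.aeval_rename _ _ _
  · rw [Ideal.mem_comap, mem_toricIdeal]
    refine Eq.trans ?_ (mem_toricIdeal.1 hf)
    exact MvPolynomial.aeval_rename _ _ _
  · rintro _ ⟨-, rfl⟩
    rw [MvPolynomial.rename_monomial, MvPolynomial.rename_monomial]
    refine pureBinomial_mem_toricIdeal.2 ?_
    rw [weight_mapDomain, weight_mapDomain, Sum.elim_comp_inl, Sum.elim_comp_inr, hz]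

end Gluing

/-! ### From few binomial generators to a gluing. -/

section Splitting

variable {K : Type*} [Field K] {G : Type*} [AddCommGroup G] {ι : Type*} {a : ι → G}

/-- The supports of the two monomials of a binomial, as a row of a sign pattern. -/
def binomialRow {ρ : Type*} (u v : ρ → ι →₀ ℕ) (t : ρ) (s : Bool) : Finset ι :=
  cond s (u t).support (v t).support

lemma monomial_mem_of_X_mem {P : Ideal (MvPolynomial ι K)} {i : ι} (hi : MvPolynomial.X i ∈ P)
    {u : ι →₀ ℕ} (hu : i ∈ u.support) : MvPolynomial.monomial u 1 ∈ P := by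
  have h : MvPolynomial.monomial u (1 : K) =
      MvPolynomial.monomial (u - Finsupp.single i 1) 1 * MvPolynomial.X i := by
    rw [MvPolynomial.X, MvPolynomial.monomial_mul, one_mul,
      Finsupp.sub_add_single_one_cancel (Finsupp.mem_support_iff.1 hu)]
  rw [h]
  exact Ideal.mul_mem_left _ _ hi

/-- The exponents of `rank` many binomials that generate a toric ideal form a dominating
pattern. -/
lemma isDominating_binomialRow [Fintype ι] [DecidableEq ι] (ha0 : ∀ i, a i ≠ 0)
    (hinv : HasNoInvertibles (AddSubmonoid.closure (Set.range a))) {m : ℕ}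
    {u v : Fin m → ι →₀ ℕ} (hm : m ≤ Module.finrank ℤ (relations a))
    (hs : Ideal.span (Set.range fun t => pureBinomial K (u t) (v t)) = toricIdeal K a) :
    IsDominating Finset.univ (binomialRow u v) := by
  classical
  intro C hC
  by_contra! hcard
  set T := mixedRows Finset.univ (binomialRow u v) C with hT
  let f : Fin m → MvPolynomial ι K := fun t => pureBinomial K (u t) (v t)
  have hf : ∀ t, f t ∈ toricIdeal K a := fun t => hs ▸ Ideal.subset_span ⟨t, rfl⟩
  -- The mixed rows are traded for the variables in `C`. If domination fails at `C`, this does not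
  -- increase the number of generators.
  let s : Finset (MvPolynomial ι K) := C.image MvPolynomial.X ∪ Tᶜ.image f
  have hscard : s.card ≤ m := by
    have h1 : (C.image (MvPolynomial.X : ι → MvPolynomial ι K)).card ≤ C.card :=
      Finset.card_image_le
    have h2 : (Tᶜ.image f).card ≤ Tᶜ.card := Finset.card_image_le
    have h3 := Finset.card_compl_add_card T
    rw [Fintype.card_fin] at h3
    have h4 := Finset.card_union_le (C.image (MvPolynomial.X : ι → MvPolynomial ι K)) (Tᶜ.image f)
    change (C.image MvPolynomial.X ∪ Tᶜ.image f).card ≤ m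
    omega
  have hne : Ideal.span (s : Set (MvPolynomial ι K)) ≠ ⊤ := by
    refine ne_top_of_le_ne_top (RingHom.ker_ne_top
      (MvPolynomial.constantCoeff : MvPolynomial ι K →+* K)) (Ideal.span_le.2 fun p hp => ?_)
    rcases Finset.mem_union.1 (Finset.mem_coe.1 hp) with hp | hp
    · obtain ⟨i, -, rfl⟩ := Finset.mem_image.1 hp
      exact RingHom.mem_ker.2 (MvPolynomial.constantCoeff_X _ i)
    · obtain ⟨t, -, rfl⟩ := Finset.mem_image.1 hp
      exact toricIdeal_le_ker_constantCoeff ha0 hinv (hf t)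
  obtain ⟨P, hP⟩ := Ideal.nonempty_minimalPrimes hne
  have hPle := Ideal.height_le_card_of_mem_minimalPrimes_span_finset hP
  have hX : ∀ i ∈ C, MvPolynomial.X i ∈ P := fun i hi =>
    hP.le (Ideal.subset_span (Finset.mem_union_left _ (Finset.mem_image_of_mem _ hi)))
  have haP : toricIdeal K a ≤ P := by
    rw [← hs]
    refine Ideal.span_le.2 (Set.range_subset_iff.2 fun t => ?_)
    by_cases ht : t ∈ T
    · have ht' := (Finset.mem_filter.1 ht).2
      obtain ⟨i, hi⟩ := ht' true
      obtain ⟨j, hj⟩ := ht' false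
      rw [Finset.mem_inter] at hi hj
      exact sub_mem (monomial_mem_of_X_mem (hX i hi.2) hi.1)
        (monomial_mem_of_X_mem (hX j hj.2) hj.1)
    · exact hP.le (Ideal.subset_span (Finset.mem_union_right _
        (Finset.mem_image_of_mem _ (Finset.mem_compl.2 ht))))
  have := hP.isPrime
  obtain ⟨P', hP', hP'P⟩ := Ideal.exists_minimalPrimes_le haP
  have := hP'.isPrime
  obtain ⟨i, hi⟩ := hC
  -- `P` contains a variable and `P'` does not, so the height of `P` is at least the rank plus one,
  -- more than Krull's bound allows.
  have hlt : P' < P := lt_of_le_of_ne hP'P fun h =>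
    X_notMem_of_mem_minimalPrimes K hP' i (h ▸ hX i hi)
  have h1 := finrank_relations_le_height_of_isPrime K a hP'.isPrime hP'.le
  have h2 := (add_le_add_left h1 1).trans (Ideal.height_add_one_le_of_lt_of_isPrime hlt)
  have h3 : Module.finrank ℤ (relations a) + 1 ≤ s.card := by exact_mod_cast h2.trans hPle
  omega

lemma exists_mapDomain_subtype {E : Finset ι} {u : ι →₀ ℕ} (hu : ∀ i ∈ u.support, i ∈ E) :
    ∃ u' : E →₀ ℕ, u'.mapDomain Subtype.val = u := by
  refine ⟨u.comapDomain Subtype.val Subtype.val_injective.injOn,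
    Finsupp.mapDomain_comapDomain _ Subtype.val_injective _ fun i hi => ⟨⟨i, hu i hi⟩, rfl⟩⟩

/-- The toric ideal of the part of the family in `E` is generated by the binomials in the variables
from `E`, if all other binomials but one do not involve these variables, and the remaining one has
exactly one monomial in these variables. -/
lemma exists_toricIdeal_restrict_eq [Finite ι] (ha0 : ∀ i, a i ≠ 0)
    (hinv : HasNoInvertibles (AddSubmonoid.closure (Set.range a))) {ρ : Type*}
    {u v : ρ → ι →₀ ℕ} (huv : ∀ t, weight a (u t) = weight a (v t)) (hne : ∀ t, u t ≠ v t)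
    (hs : Ideal.span (Set.range fun t => pureBinomial K (u t) (v t)) = toricIdeal K a) {E : Finset ι}
    {t₀ : ρ} (hu₀ : ∀ i ∈ (u t₀).support, i ∈ E) (hv₀ : ∀ i ∈ (v t₀).support, i ∉ E) {T : Finset ρ}
    (hTu : ∀ t ∈ T, ∀ i ∈ (u t).support, i ∈ E) (hTv : ∀ t ∈ T, ∀ i ∈ (v t).support, i ∈ E)
    (hTu' : ∀ t ∉ T, t ≠ t₀ → ∀ i ∈ (u t).support, i ∉ E)
    (hTv' : ∀ t ∉ T, t ≠ t₀ → ∀ i ∈ (v t).support, i ∉ E) :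
    ∃ u' v' : Fin T.card → E →₀ ℕ,
      (∀ t, weight (fun i : E => a i) (u' t) = weight (fun i : E => a i) (v' t)) ∧
      (∀ t, u' t ≠ v' t) ∧ Ideal.span (Set.range fun t => pureBinomial K (u' t) (v' t)) =
        toricIdeal K fun i : E => a i := by
  classical
  have hzero : ∀ w : ι →₀ ℕ, weight a w = 0 → w = 0 := fun w => eq_zero_of_weight_eq_zero ha0 hinv
  have hu0 : ∀ t, u t ≠ 0 := fun t h => hne t (by
    rw [h, hzero (v t) (by rw [← huv, h, map_zero])])
  have hv0 : ∀ t, v t ≠ 0 := fun t h => hne t (by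
    rw [h, hzero (u t) (by rw [huv, h, map_zero])])
  -- Setting the variables outside `E` to zero keeps the binomials in `T`, turns the cut binomial
  -- into the monomial x^w and kills the others.
  let φ : MvPolynomial ι K →ₐ[K] MvPolynomial E K :=
    MvPolynomial.aeval fun i => if h : i ∈ E then MvPolynomial.X ⟨i, h⟩ else 0
  have hφX : ∀ i ∉ E, φ (MvPolynomial.X i) = 0 := fun i hi => by
    rw [MvPolynomial.aeval_X, dif_neg hi]
  have hφrename : ∀ f, φ (MvPolynomial.rename Subtype.val f) = f := fun f => by
    have : (fun i => if h : i ∈ E then (MvPolynomial.X ⟨i, h⟩ : MvPolynomial E K) else 0) ∘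
        (Subtype.val : E → ι) = MvPolynomial.X := by
      funext i
      simp
    rw [MvPolynomial.aeval_rename, this]
    exact MvPolynomial.aeval_X_left_apply f
  have hφmon : ∀ w : E →₀ ℕ, φ (MvPolynomial.monomial (w.mapDomain Subtype.val) 1) =
      MvPolynomial.monomial w 1 := fun w => by
    rw [← MvPolynomial.rename_monomial, hφrename]
  have hφ0 : ∀ w : ι →₀ ℕ, w ≠ 0 → (∀ i ∈ w.support, i ∉ E) →
      φ (MvPolynomial.monomial w 1) = 0 := by
    intro w hw hwE
    obtain ⟨i, hi⟩ := Finsupp.support_nonempty_iff.2 hw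
    exact RingHom.mem_ker.1 (monomial_mem_of_X_mem (P := RingHom.ker φ)
      (RingHom.mem_ker.2 (hφX i (hwE i hi))) hi)
  have hrename : ∀ f ∈ toricIdeal K (fun i : E => a i),
      MvPolynomial.rename Subtype.val f ∈ toricIdeal K a := fun f hf => by
    rw [mem_toricIdeal] at hf ⊢
    exact (MvPolynomial.aeval_rename _ _ _).trans hf
  have hinvE : HasNoInvertibles (AddSubmonoid.closure (Set.range fun i : E => a i)) := by
    have hle : AddSubmonoid.closure (Set.range fun i : E => a i) ≤
        AddSubmonoid.closure (Set.range a) :=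
      AddSubmonoid.closure_mono (by rintro _ ⟨i, rfl⟩; exact ⟨i, rfl⟩)
    exact fun x hx hx' => hinv x (hle hx) (hle hx')
  choose u' hu' using fun t : T => exists_mapDomain_subtype (hTu t t.2)
  choose v' hv' using fun t : T => exists_mapDomain_subtype (hTv t t.2)
  obtain ⟨w, hw⟩ := exists_mapDomain_subtype hu₀
  have hw0 : w ≠ 0 := by
    rintro rfl
    exact hu0 t₀ (by rw [← hw, Finsupp.mapDomain_zero])
  have huv' : ∀ t, weight (fun i : E => a i) (u' t) = weight (fun i : E => a i) (v' t) := fun t => by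
    have := huv t
    rwa [← hu', ← hv', weight_mapDomain, weight_mapDomain] at this
  let e := T.equivFin.symm
  refine ⟨fun t => u' (e t), fun t => v' (e t), fun t => huv' (e t), fun t ht => ?_,
    le_antisymm (Ideal.span_le.2 (Set.range_subset_iff.2 fun t => ?_)) ?_⟩
  · refine hne (e t) ?_
    rw [← hu', ← hv']
    exact congrArg _ ht
  · exact pureBinomial_mem_toricIdeal.2 (huv' (e t))
  set J := Ideal.span (Set.range fun t => pureBinomial K (u' (e t)) (v' (e t))) with hJ
  refine toricIdeal_le_of_le_sup_mul (a := fun i : E => a i) (fun i => ha0 i) hinvE ?_ fun f hf => ?_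
  · rintro _ ⟨t, rfl⟩
    exact ⟨_, isWeightedHomogeneous_pureBinomial (huv' (e t))⟩
  have hmap : (toricIdeal K a).map φ ≤ J ⊔ Ideal.span {MvPolynomial.monomial w 1} := by
    rw [← hs, Ideal.map_span, Ideal.span_le]
    rintro _ ⟨_, ⟨t, rfl⟩, rfl⟩
    simp only [pureBinomial, map_sub]
    by_cases ht : t ∈ T
    · refine Ideal.mem_sup_left ?_
      have h1 := hφmon (u' ⟨t, ht⟩)
      have h2 := hφmon (v' ⟨t, ht⟩)
      rw [hu'] at h1
      rw [hv'] at h2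
      rw [h1, h2]
      exact Ideal.subset_span ⟨e.symm ⟨t, ht⟩, by simp [pureBinomial]⟩
    · by_cases ht₀ : t = t₀
      · subst ht₀
        rw [hφ0 (v t) (hv0 t) hv₀, sub_zero, ← hw, hφmon]
        exact Ideal.mem_sup_right (Ideal.mem_span_singleton_self _)
      · rw [hφ0 (u t) (hu0 t) (hTu' t ht ht₀), hφ0 (v t) (hv0 t) (hTv' t ht ht₀), sub_zero]
        exact zero_mem _
  have hf' := hmap (Ideal.mem_map_of_mem φ (hrename f hf))
  rw [hφrename] at hf'
  obtain ⟨p, hp, q, hq, rfl⟩ := Submodule.mem_sup.1 hf'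
  obtain ⟨g, rfl⟩ := Ideal.mem_span_singleton'.1 hq
  refine Submodule.add_mem_sup hp ?_
  have hpI : p ∈ toricIdeal K fun i : E => a i :=
    Ideal.span_le.2 (Set.range_subset_iff.2 fun t => pureBinomial_mem_toricIdeal.2 (huv' (e t))) hp
  -- The multiple g x^w of the leftover monomial lies in the toric ideal, so g does too. As x^w has
  -- no constant term, the product is absorbed by Nakayama.
  have hg := (Submodule.add_mem_iff_right _ hpI).1 hf
  rw [mul_comm] at hg
  rw [mul_comm g]
  refine Ideal.mul_mem_mul ?_ (monomial_mul_mem_toricIdeal.1 hg)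
  rw [RingHom.mem_ker, MvPolynomial.constantCoeff_monomial, if_neg hw0]

lemma relations_le_of_toricIdeal_le [Fintype ι] {H : Type*} [AddCommGroup H] {b : ι → H}
    (h : toricIdeal K a ≤ toricIdeal K b) : relations a ≤ relations b := by
  intro α hα
  rw [← expDiff_posPart' α] at hα ⊢
  exact expDiff_mem_relations.2 (pureBinomial_mem_toricIdeal.1
    (h (pureBinomial_mem_toricIdeal.2 (expDiff_mem_relations.1 hα))))

lemma exists_linearCombination_eq [Fintype ι] {E : Set ι} {x : G}
    (hx : x ∈ AddSubgroup.closure (a '' E)) :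
    ∃ α : ι → ℤ, (∀ i ∉ E, α i = 0) ∧ Fintype.linearCombination ℤ a α = x := by
  classical
  induction hx using AddSubgroup.closure_induction with
  | mem x hx =>
    obtain ⟨i, hi, rfl⟩ := hx
    refine ⟨Pi.single i 1, fun j hj => Pi.single_eq_of_ne (fun h : j = i => hj (by rw [h]; exact hi)) _, ?_⟩
    simp
  | zero => exact ⟨0, fun _ _ => rfl, map_zero _⟩
  | add x y _ _ hx hy =>
    obtain ⟨α, hα, rfl⟩ := hx
    obtain ⟨β, hβ, rfl⟩ := hy
    exact ⟨α + β, fun i hi => by simp [hα i hi, hβ i hi], map_add _ _ _⟩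
  | neg x _ hx =>
    obtain ⟨α, hα, rfl⟩ := hx
    exact ⟨-α, fun i hi => by simp [hα i hi], map_neg _ _⟩

/-- A cut of the binomials that generate the toric ideal yields a gluing. -/
lemma closure_inf_closure_le_zmultiples [Fintype ι] {ρ : Type*} {u v : ρ → ι →₀ ℕ}
    (huv : ∀ t, weight a (u t) = weight a (v t))
    (hs : Ideal.span (Set.range fun t => pureBinomial K (u t) (v t)) = toricIdeal K a) {E : Set ι}
    {t₀ : ρ} (hu₀ : ∀ i ∈ (u t₀).support, i ∈ E) (hv₀ : ∀ i ∈ (v t₀).support, i ∉ E)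
    (hE : ∀ t, t ≠ t₀ → ((∀ i ∈ (u t).support, i ∈ E) ∧ ∀ i ∈ (v t).support, i ∈ E) ∨
      ((∀ i ∈ (u t).support, i ∉ E) ∧ ∀ i ∈ (v t).support, i ∉ E)) :
    AddSubgroup.closure (a '' E) ⊓ AddSubgroup.closure (a '' Eᶜ) ≤
      AddSubgroup.zmultiples (weight a (u t₀)) := by
  classical
  intro x hx
  obtain ⟨α, hα, hαx⟩ := exists_linearCombination_eq (AddSubgroup.mem_inf.1 hx).1
  obtain ⟨β, hβ, hβx⟩ := exists_linearCombination_eq (AddSubgroup.mem_inf.1 hx).2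
  let π := QuotientAddGroup.mk' (AddSubgroup.zmultiples (weight a (u t₀)))
  -- In this new grading, generators outside `E` have degree 0 and those in `E` keep their degree
  -- modulo the cut degree. All given binomials remain homogeneous, hence every relation of `a`
  -- holds for `q`; comparing the two expressions of `x` shows that `x` vanishes in the quotient.
  let q : ι → G ⧸ AddSubgroup.zmultiples (weight a (u t₀)) := fun i => if i ∈ E then π (a i) else 0
  have hin : ∀ w : ι →₀ ℕ, (∀ i ∈ w.support, i ∈ E) → weight q w = π (weight a w) := by
    intro w hw
    rw [Finsupp.weight_apply q w, Finsupp.weight_apply a w, Finsupp.sum, Finsupp.sum, map_sum]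
    exact Finset.sum_congr rfl fun i hi => by simp only [q, if_pos (hw i hi), map_nsmul]
  have hout : ∀ w : ι →₀ ℕ, (∀ i ∈ w.support, i ∉ E) → weight q w = 0 := by
    intro w hw
    rw [Finsupp.weight_apply q w, Finsupp.sum]
    exact Finset.sum_eq_zero fun i hi => by simp only [q, if_neg (hw i hi), smul_zero]
  have hle : relations a ≤ relations q := by
    refine relations_le_of_toricIdeal_le (K := K) ?_
    rw [← hs]
    refine Ideal.span_le.2 (Set.range_subset_iff.2 fun t => pureBinomial_mem_toricIdeal.2 ?_)
    by_cases ht : t = t₀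
    · subst ht
      rw [hin _ hu₀, hout _ hv₀]
      exact (QuotientAddGroup.eq_zero_iff _).2 (AddSubgroup.mem_zmultiples _)
    · rcases hE t ht with ⟨h1, h2⟩ | ⟨h1, h2⟩
      · exact (hin _ h1).trans ((congrArg π (huv t)).trans (hin _ h2).symm)
      · rw [hout _ h1, hout _ h2]
  have hmem : α - β ∈ relations q := hle (by
    rw [relations, LinearMap.mem_ker, map_sub, hαx, hβx, sub_self])
  rw [relations, LinearMap.mem_ker, Fintype.linearCombination_apply] at hmem
  have hsum : ∑ i, (α - β) i • q i = π (Fintype.linearCombination ℤ a α) := by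
    rw [Fintype.linearCombination_apply, map_sum]
    refine Finset.sum_congr rfl fun i _ => ?_
    by_cases hi : i ∈ E
    · simp only [q, if_pos hi, Pi.sub_apply, hβ i (fun h => h hi), sub_zero, map_zsmul]
    · simp only [q, if_neg hi, hα i hi, smul_zero, zero_smul, map_zero]
  rw [hsum, hαx] at hmem
  exact (QuotientAddGroup.eq_zero_iff _).1 hmem

lemma linearIndependent_of_toricIdeal_eq_bot [Fintype ι] (h : toricIdeal K a = ⊥) :
    LinearIndependent ℤ a := by
  rw [Fintype.linearIndependent_iff]
  intro g hg i
  have hmem : pureBinomial K (posPart' g) (posPart' (-g)) ∈ toricIdeal K a := by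
    rw [pureBinomial_mem_toricIdeal, ← expDiff_mem_relations, expDiff_posPart']
    exact hg
  rw [h, Ideal.mem_bot, pureBinomial, sub_eq_zero] at hmem
  have heq := MvPolynomial.monomial_left_injective one_ne_zero hmem
  rw [← expDiff_posPart' g, heq]
  simp [expDiff]

lemma weight_mem_closure_image {E : Finset ι} {u : ι →₀ ℕ} (hu : ∀ i ∈ u.support, i ∈ E) :
    weight a u ∈ AddSubmonoid.closure (a '' E) := by
  obtain ⟨w, rfl⟩ := exists_mapDomain_subtype hu
  rw [weight_mapDomain]
  refine AddSubmonoid.closure_mono ?_ (weight_mem_closure _ w)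
  rintro _ ⟨i, rfl⟩
  exact ⟨i, i.2, rfl⟩

lemma range_comp_coe_finset {X : Type*} (a : ι → X) (E : Finset ι) :
    Set.range (fun i : E => a i) = a '' E := by
  ext x
  simp

/-- A family whose toric ideal is generated by few binomials is independent or can be split. -/
lemma HasFewBinomialGenerators.linearIndependent_or_exists_gluing [Fintype ι] [DecidableEq ι]
    (h : HasFewBinomialGenerators K a) (ha0 : ∀ i, a i ≠ 0)
    (hinv : HasNoInvertibles (AddSubmonoid.closure (Set.range a))) :
    LinearIndependent ℤ a ∨ ∃ (E : Finset ι) (c : G), E.Nonempty ∧ Eᶜ.Nonempty ∧ c ≠ 0 ∧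
      c ∈ AddSubmonoid.closure (a '' E) ∧ c ∈ AddSubmonoid.closure (a '' (Eᶜ : Finset ι)) ∧
      AddSubgroup.zmultiples c =
        AddSubgroup.closure (a '' E) ⊓ AddSubgroup.closure (a '' (Eᶜ : Finset ι)) ∧
      HasFewBinomialGenerators K (fun i : E => a i) ∧
      HasFewBinomialGenerators K (fun i : (Eᶜ : Finset ι) => a i) := by
  obtain ⟨m, u, v, hm, huv, hne, hs⟩ := h
  rcases Nat.eq_zero_or_pos m with rfl | hmpos
  · refine Or.inl (linearIndependent_of_toricIdeal_eq_bot (K := K) ?_)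
    rw [← hs, Set.range_eq_empty, Ideal.span_empty]
  have hzero : ∀ w : ι →₀ ℕ, weight a w = 0 → w = 0 := fun w => eq_zero_of_weight_eq_zero ha0 hinv
  have hu0 : ∀ t, u t ≠ 0 := fun t h => hne t (by
    rw [h, hzero (v t) (by rw [← huv, h, map_zero])])
  have hv0 : ∀ t, v t ≠ 0 := fun t h => hne t (by
    rw [h, hzero (u t) (by rw [huv, h, map_zero])])
  obtain ⟨t₀, -, E₀, ⟨s, hs1, hs2⟩, hcut⟩ := IsDominating.exists_rowCut m Finset.univ
    (binomialRow u v) (Finset.card_fin m) ⟨⟨0, hmpos⟩, Finset.mem_univ _⟩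
    (fun t _ s => by
      cases s
      · exact Finsupp.support_nonempty_iff.2 (hv0 t)
      · exact Finsupp.support_nonempty_iff.2 (hu0 t))
    (isDominating_binomialRow ha0 hinv hm hs)
  obtain ⟨E, hu₀, hv₀, hE⟩ : ∃ E : Finset ι, (∀ i ∈ (u t₀).support, i ∈ E) ∧
      (∀ i ∈ (v t₀).support, i ∉ E) ∧ ∀ t, t ≠ t₀ →
        ((∀ i ∈ (u t).support, i ∈ E) ∧ ∀ i ∈ (v t).support, i ∈ E) ∨
        ((∀ i ∈ (u t).support, i ∉ E) ∧ ∀ i ∈ (v t).support, i ∉ E) := by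
    have hcut' : ∀ t, t ≠ t₀ →
        ((∀ i ∈ (u t).support, i ∈ E₀) ∧ ∀ i ∈ (v t).support, i ∈ E₀) ∨
        ((∀ i ∈ (u t).support, i ∉ E₀) ∧ ∀ i ∈ (v t).support, i ∉ E₀) := fun t ht =>
      (hcut t (Finset.mem_univ t) ht).imp (fun h => ⟨h true, h false⟩)
        fun h => ⟨fun _ hi => Finset.disjoint_left.1 (h true) hi,
          fun _ hi => Finset.disjoint_left.1 (h false) hi⟩
    cases s
    · refine ⟨E₀ᶜ, fun i hi => Finset.mem_compl.2 (Finset.disjoint_left.1 hs2 hi),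
        fun i hi h => Finset.mem_compl.1 h (hs1 hi), fun t ht => ?_⟩
      simpa only [Finset.mem_compl, not_not] using (hcut' t ht).symm
    · exact ⟨E₀, fun _ hi => hs1 hi, fun _ hi => Finset.disjoint_left.1 hs2 hi, hcut'⟩
  have hv₀' : ∀ i ∈ (v t₀).support, i ∈ Eᶜ := fun i hi => Finset.mem_compl.2 (hv₀ i hi)
  have hcE : weight a (u t₀) ∈ AddSubmonoid.closure (a '' E) := weight_mem_closure_image hu₀
  have hcE' : weight a (u t₀) ∈ AddSubmonoid.closure (a '' (Eᶜ : Finset ι)) :=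
    huv t₀ ▸ weight_mem_closure_image hv₀'
  have hc0 : weight a (u t₀) ≠ 0 := fun h => hu0 t₀ (hzero _ h)
  have hinter : AddSubgroup.zmultiples (weight a (u t₀)) =
      AddSubgroup.closure (a '' E) ⊓ AddSubgroup.closure (a '' (Eᶜ : Finset ι)) := by
    refine le_antisymm (AddSubgroup.zmultiples_le_of_mem
      ⟨AddSubgroup.le_closure_toAddSubmonoid _ hcE,
        AddSubgroup.le_closure_toAddSubmonoid _ hcE'⟩) ?_
    rw [Finset.coe_compl]
    exact closure_inf_closure_le_zmultiples huv hs hu₀ hv₀ hE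
  let T := Finset.univ.filter fun t => t ≠ t₀ ∧ ∀ i ∈ (u t).support, i ∈ E
  let T' := Finset.univ.filter fun t => t ≠ t₀ ∧ ∀ i ∈ (u t).support, i ∉ E
  have hT : ∀ t ∈ T, (∀ i ∈ (u t).support, i ∈ E) ∧ ∀ i ∈ (v t).support, i ∈ E := by
    intro t ht
    obtain ⟨ht, hut⟩ := (Finset.mem_filter.1 ht).2
    obtain ⟨i, hi⟩ := Finsupp.support_nonempty_iff.2 (hu0 t)
    exact (hE t ht).resolve_right fun h => h.1 i hi (hut i hi)
  have hT' : ∀ t ∈ T', (∀ i ∈ (u t).support, i ∉ E) ∧ ∀ i ∈ (v t).support, i ∉ E := by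
    intro t ht
    obtain ⟨ht, hut⟩ := (Finset.mem_filter.1 ht).2
    obtain ⟨i, hi⟩ := Finsupp.support_nonempty_iff.2 (hu0 t)
    exact (hE t ht).resolve_left fun h => hut i hi (h.1 i hi)
  have hTc : ∀ t ∉ T, t ≠ t₀ → (∀ i ∈ (u t).support, i ∉ E) ∧ ∀ i ∈ (v t).support, i ∉ E :=
    fun t ht htt => (hE t htt).resolve_left fun h =>
      ht (Finset.mem_filter.2 ⟨Finset.mem_univ _, htt, h.1⟩)
  have hTc' : ∀ t ∉ T', t ≠ t₀ → (∀ i ∈ (u t).support, i ∈ E) ∧ ∀ i ∈ (v t).support, i ∈ E :=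
    fun t ht htt => (hE t htt).resolve_right fun h =>
      ht (Finset.mem_filter.2 ⟨Finset.mem_univ _, htt, h.1⟩)
  have hcard : T.card + T'.card + 1 ≤ m := by
    have hdisj : Disjoint T T' := Finset.disjoint_left.2 fun t ht ht' => by
      obtain ⟨i, hi⟩ := Finsupp.support_nonempty_iff.2 (hu0 t)
      exact (hT' t ht').1 i hi ((hT t ht).1 i hi)
    have hnot : t₀ ∉ T ∪ T' := by simp [T, T']
    rw [← Finset.card_union_of_disjoint hdisj, ← Finset.card_insert_of_notMem hnot]
    exact (Finset.card_le_univ _).trans_eq (Fintype.card_fin m)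
  obtain ⟨u₁, v₁, huv₁, hne₁, hs₁⟩ := exists_toricIdeal_restrict_eq ha0 hinv huv hne hs hu₀ hv₀
    (fun t ht => (hT t ht).1) (fun t ht => (hT t ht).2) (fun t ht htt => (hTc t ht htt).1)
    (fun t ht htt => (hTc t ht htt).2)
  have hs' : Ideal.span (Set.range fun t => pureBinomial K (v t) (u t)) = toricIdeal K a := by
    rw [← hs]
    refine le_antisymm (Ideal.span_le.2 (Set.range_subset_iff.2 fun t => ?_))
      (Ideal.span_le.2 (Set.range_subset_iff.2 fun t => ?_))
    · rw [pureBinomial, ← neg_sub]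
      exact neg_mem (Ideal.subset_span ⟨t, rfl⟩)
    · rw [pureBinomial, ← neg_sub]
      exact neg_mem (Ideal.subset_span ⟨t, rfl⟩)
  obtain ⟨u₂, v₂, huv₂, hne₂, hs₂⟩ := exists_toricIdeal_restrict_eq ha0 hinv
    (fun t => (huv t).symm) (fun t => (hne t).symm) hs' hv₀'
    (fun i hi h => Finset.mem_compl.1 h (hu₀ i hi))
    (fun t ht i hi => Finset.mem_compl.2 ((hT' t ht).2 i hi))
    (fun t ht i hi => Finset.mem_compl.2 ((hT' t ht).1 i hi))
    (fun t ht htt i hi h => Finset.mem_compl.1 h ((hTc' t ht htt).2 i hi))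
    (fun t ht htt i hi h => Finset.mem_compl.1 h ((hTc' t ht htt).1 i hi))
  -- Each side needs at least as many binomials as its rank. Since the ranks add up to the total
  -- rank minus one and at most that many binomials are left, equality holds on both sides.
  have hr₁ := finrank_relations_le_card K hs₁
  have hr₂ := finrank_relations_le_card K hs₂
  rw [Fintype.card_fin] at hr₁ hr₂
  have hr := finrank_relations_sumElim_of_gluing (a := fun i : E => a i)
    (b := fun i : (Eᶜ : Finset ι) => a i)
    (fun n hn => eq_zero_of_nsmul_eq_zero hinv (weight_mem_closure a (u t₀)) hc0 hn)
    (by rw [range_comp_coe_finset, range_comp_coe_finset]; exact hinter)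
  have hr' := finrank_relations_add_finrank_span a
  have hr'' := finrank_relations_add_finrank_span
    (Sum.elim (fun i : E => a i) fun i : (Eᶜ : Finset ι) => a i)
  rw [Set.Sum.elim_range, range_comp_coe_finset, range_comp_coe_finset, ← Set.image_union,
    ← Finset.coe_union, Finset.union_compl, Finset.coe_univ, Set.image_univ, Fintype.card_sum,
    Fintype.card_coe, Fintype.card_coe, Finset.card_add_card_compl] at hr''
  obtain ⟨i, hi⟩ := Finsupp.support_nonempty_iff.2 (hu0 t₀)
  obtain ⟨j, hj⟩ := Finsupp.support_nonempty_iff.2 (hv0 t₀)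
  exact Or.inr ⟨E, _, ⟨i, hu₀ i hi⟩, ⟨j, hv₀' j hj⟩, hc0, hcE, hcE', hinter,
    ⟨_, u₁, v₁, by omega, huv₁, hne₁, hs₁⟩, ⟨_, u₂, v₂, by omega, huv₂, hne₂, hs₂⟩⟩

end Splitting

/-! ### Few generators are equivalent to being completely glued. -/

section Characterization

variable {K : Type*} [Field K] {G : Type*} [AddCommGroup G]

lemma HasNoInvertibles.mono {S T : AddSubmonoid G} (hT : HasNoInvertibles T) (h : S ≤ T) :
    HasNoInvertibles S :=
  fun x hx hx' => hT x (h hx) (h hx')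

lemma HasFewBinomialGenerators.isCompletelyGlued {ι : Type*} [Fintype ι] {a : ι → G}
    (h : HasFewBinomialGenerators K a) (ha0 : ∀ i, a i ≠ 0)
    (hinv : HasNoInvertibles (AddSubmonoid.closure (Set.range a))) :
    IsCompletelyGlued (AddSubmonoid.closure (Set.range a)) := by
  classical
  induction hn : Fintype.card ι using Nat.strong_induction_on generalizing ι with
  | _ n ih =>
    subst hn
    let e := (Fintype.equivFin ι).symm
    have hrange : Set.range (a ∘ e) = Set.range a := EquivLike.range_comp a e
    have himage : ∀ E : Set ι, (a ∘ e) '' (e ⁻¹' E) = a '' E := fun E => by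
      rw [Set.image_comp, Set.image_preimage_eq _ e.surjective]
    rcases h.linearIndependent_or_exists_gluing ha0 hinv with
      hlin | ⟨E, c, hE, hE', hc0, hcE, hcE', hc, h1, h2⟩
    · rw [← hrange]
      exact .of_linearIndependent _ (hlin.comp e e.injective)
    have hsub : ∀ E : Finset ι, Eᶜ.Nonempty → HasFewBinomialGenerators K (fun i : E => a i) →
        IsCompletelyGlued (AddSubmonoid.closure (a '' E)) := by
      intro E hE hfew
      rw [← range_comp_coe_finset]
      refine ih _ ?_ hfew (fun i => ha0 i) (hinv.mono (AddSubmonoid.closure_mono ?_)) rfl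
      · have := Finset.card_add_card_compl E
        have := hE.card_pos
        rw [Fintype.card_coe]
        omega
      · rintro _ ⟨i, rfl⟩
        exact ⟨i, rfl⟩
    rw [← hrange]
    refine .glue (a ∘ e) (e ⁻¹' E) (e ⁻¹' (Eᶜ : Finset ι)) (hrange ▸ hinv) ⟨?_, ?_, ?_, ?_, c, hc0, ?_⟩
      ?_ ?_
    · exact Set.Nonempty.preimage (Finset.coe_nonempty.2 hE) e.surjective
    · exact Set.Nonempty.preimage (Finset.coe_nonempty.2 hE') e.surjective
    · rw [← Set.preimage_union, ← Finset.coe_union, Finset.union_compl, Finset.coe_univ,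
        Set.preimage_univ]
    · rw [← Set.preimage_inter, ← Finset.coe_inter, Finset.inter_compl, Finset.coe_empty,
        Set.preimage_empty]
    · rw [himage, himage]
      exact ⟨⟨hcE, hcE'⟩, hc⟩
    · rw [himage]
      exact hsub E hE' h1
    · rw [himage]
      exact hsub Eᶜ (by rwa [compl_compl]) h2

lemma HasFewGenerators.of_linearIndependent {ι : Type*} [Fintype ι] {a : ι → G}
    (h : LinearIndependent ℤ a) : HasFewGenerators K a := by
  refine ⟨∅, Nat.zero_le _, ?_⟩
  rw [Finset.coe_empty, Ideal.span_empty, eq_comm, eq_bot_iff]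
  refine toricIdeal_le fun u v huv => ?_
  have h0 := expDiff_mem_relations.2 huv
  have : u = v := by
    ext i
    have := Fintype.linearIndependent_iff.1 h _ h0 i
    rw [expDiff] at this
    omega
  rw [this, pureBinomial, sub_self]
  exact zero_mem _

/-- The generators are built along the gluing tree rather than taken from `a`: gluing depends only
on the monoids and groups generated, so the families found for the two parts can simply be joined.
-/
lemma IsCompletelyGlued.exists_hasFewGenerators {S : AddSubmonoid G} (h : IsCompletelyGlued S)
    (hS : HasNoInvertibles S) : ∃ (ι : Type) (_ : Fintype ι) (b : ι → G),
      AddSubmonoid.closure (Set.range b) = S ∧ HasFewGenerators K b := by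
  induction h with
  | of_linearIndependent b hb => exact ⟨_, _, b, rfl, .of_linearIndependent hb⟩
  | glue a E₁ E₂ ha h h₁ h₂ ih₁ ih₂ =>
    obtain ⟨-, -, hE, -, c, hc0, hc, hcz⟩ := h
    have hsub : ∀ E, AddSubmonoid.closure (a '' E) ≤ AddSubmonoid.closure (Set.range a) := fun E =>
      AddSubmonoid.closure_mono (Set.image_subset_range a E)
    obtain ⟨κ₁, _, b₁, hb₁, hf₁⟩ := ih₁ (hS.mono (hsub _))
    obtain ⟨κ₂, _, b₂, hb₂, hf₂⟩ := ih₂ (hS.mono (hsub _))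
    have hgroup : ∀ s t : Set G, AddSubmonoid.closure s = AddSubmonoid.closure t →
        AddSubgroup.closure s = AddSubgroup.closure t := by
      have hle : ∀ s t : Set G, AddSubmonoid.closure s ≤ AddSubmonoid.closure t →
          AddSubgroup.closure s ≤ AddSubgroup.closure t := fun s t h =>
        (AddSubgroup.closure_le _).2 fun x hx => AddSubgroup.le_closure_toAddSubmonoid t
          (h (AddSubmonoid.subset_closure hx))
      exact fun s t h => le_antisymm (hle s t h.le) (hle t s h.ge)
    refine ⟨κ₁ ⊕ κ₂, inferInstance, Sum.elim b₁ b₂, ?_, hf₁.of_gluing hf₂ ?_ hc0 ?_ ?_ ?_⟩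
    · rw [Set.Sum.elim_range, AddSubmonoid.closure_union, hb₁, hb₂, ← AddSubmonoid.closure_union,
        ← Set.image_union, hE, Set.image_univ]
    · rw [hb₁]
      exact hS.mono (hsub _)
    · rw [hb₁]
      exact hc.1
    · rw [hb₂]
      exact hc.2
    · rw [hcz, hgroup _ _ hb₁, hgroup _ _ hb₂]

lemma hasFewGenerators_iff_isCompletelyGlued {ι : Type*} [Fintype ι] {a : ι → G}
    (hinv : HasNoInvertibles (AddSubmonoid.closure (Set.range a))) :
    HasFewGenerators K a ↔ IsCompletelyGlued (AddSubmonoid.closure (Set.range a)) := by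
  classical
  refine ⟨fun h => ?_, fun h => ?_⟩
  · rw [← closure_range_ne_zero] at hinv ⊢
    exact (h.hasFewBinomialGenerators (fun i => i.2) hinv
      (closure_range_ne_zero a)).isCompletelyGlued (fun i => i.2) hinv
  · obtain ⟨κ, _, b, hb, hf⟩ := h.exists_hasFewGenerators (K := K) hinv
    exact hf.of_closure_eq hinv hb.symm

end Characterization

/-! ### Translation to lattice ideals and heights. -/

section CompleteIntersection

variable {G : Type*} [AddCommGroup G] {m : ℕ} (a : Fin m → G)

lemma latticeBinomial_eq_pureBinomial (K : Type*) [Field K] (α : Fin m → ℤ) :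
    latticeBinomial K α = pureBinomial K (posPart' α) (posPart' (-α)) := by
  rw [latticeBinomial, pureBinomial, MvPolynomial.monomial_eq, MvPolynomial.monomial_eq,
    Finsupp.prod_fintype _ _ fun _ => pow_zero _, Finsupp.prod_fintype _ _ fun _ => pow_zero _,
    map_one, one_mul, one_mul]
  rfl

/-- A binomial whose monomials share factors is the common monomial times the binomial of the
difference vector. -/
lemma latticeIdeal_eq_toricIdeal (K : Type*) [Field K] :
    latticeIdeal K (relationLattice a) = toricIdeal K a := by
  refine le_antisymm (Ideal.span_le.2 ?_) (toricIdeal_le fun u v huv => ?_)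
  · rintro _ ⟨α, hα, rfl⟩
    rw [latticeBinomial_eq_pureBinomial]
    refine pureBinomial_mem_toricIdeal.2 (expDiff_mem_relations.1 ?_)
    rwa [expDiff_posPart']
  · have hmem : latticeBinomial K (expDiff u v) ∈ latticeIdeal K (relationLattice a) :=
      Ideal.subset_span ⟨_, expDiff_mem_relations.2 huv, rfl⟩
    rw [latticeBinomial_eq_pureBinomial] at hmem
    have hu : u = u ⊓ v + posPart' (expDiff u v) := by
      ext i
      rw [Finsupp.add_apply, posPart'_apply, Finsupp.inf_apply, expDiff]
      omega
    have hv : v = u ⊓ v + posPart' (-expDiff u v) := by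
      ext i
      rw [Finsupp.add_apply, posPart'_apply, Finsupp.inf_apply, Pi.neg_apply, expDiff]
      omega
    have heq : pureBinomial K u v =
        MvPolynomial.monomial (u ⊓ v) 1 *
          pureBinomial K (posPart' (expDiff u v)) (posPart' (-expDiff u v)) := by
      rw [pureBinomial, pureBinomial, mul_sub, MvPolynomial.monomial_mul, MvPolynomial.monomial_mul, one_mul,
        ← hu, ← hv]
    rw [heq]
    exact Ideal.mul_mem_left _ _ hmem

/-- The height is the rank and never exceeds the minimal number of generators, so equality only
requires that many generators to suffice. -/
lemma isCompleteIntersectionSemigroup_iff :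
    IsCompleteIntersectionSemigroup a ↔ HasFewGenerators ℚ a := by
  rw [IsCompleteIntersectionSemigroup, IsCompleteIntersectionIdeal, latticeIdeal_eq_toricIdeal]
  have hheight : (toricIdeal ℚ a).height = (Module.finrank ℤ (relations a) : ℕ∞) :=
    le_antisymm (height_toricIdeal_le ℚ a) (finrank_relations_le_height ℚ a)
  have hle := Ideal.height_le_spanFinrank (toricIdeal ℚ a) (toricIdeal_ne_top ℚ a)
  rw [hheight] at hle ⊢
  rw [Nat.cast_le] at hle
  rw [Nat.cast_inj]
  refine ⟨fun h => ?_, fun ⟨s, hs, hspan⟩ => le_antisymm ?_ hle⟩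
  · obtain ⟨s, hs, hspan⟩ := Submodule.FG.exists_span_finset_card_eq_spanFinrank
      (IsNoetherian.noetherian (toricIdeal ℚ a))
    exact ⟨s, (hs.trans h).le, hspan⟩
  · refine le_trans ?_ hs
    rw [← hspan, ← Set.ncard_coe_finset]
    exact Submodule.spanFinrank_span_le_ncard_of_finite s.finite_toSet

end CompleteIntersection

/-! ### Free affine semigroups and linear independence. -/

section Affine

variable {G : Type*} [AddCommGroup G]

lemma exists_linearIndependent_of_addEquiv {F : AddSubmonoid G} {k : ℕ} (e : F ≃+ (Fin k → ℕ)) :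
    ∃ b : Fin k → G, LinearIndependent ℤ b ∧ AddSubmonoid.closure (Set.range b) = F := by
  classical
  let b : Fin k → G := fun i => e.symm (Pi.single i 1)
  have hb : ∀ n : Fin k → ℕ, ∑ i, n i • b i = e.symm n := by
    intro n
    conv_rhs => rw [← Finset.univ_sum_single n]
    rw [map_sum, AddSubmonoid.coe_finsetSum]
    refine Finset.sum_congr rfl fun i _ => ?_
    rw [← AddSubmonoidClass.coe_nsmul, ← map_nsmul, ← Pi.single_smul, smul_eq_mul, mul_one]
  refine ⟨b, Fintype.linearIndependent_iff.2 fun g hg i => ?_,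
    le_antisymm (AddSubmonoid.closure_le.2 ?_) fun x hx => ?_⟩
  -- An integral relation is split into its positive and negative parts, which are then compared
  -- inside the free monoid.
  · have h : ∑ i, (g i).toNat • b i = ∑ i, (-g i).toNat • b i := by
      rw [← sub_eq_zero, ← Finset.sum_sub_distrib, ← hg]
      refine Finset.sum_congr rfl fun i _ => ?_
      rw [← natCast_zsmul, ← natCast_zsmul, ← sub_smul, Int.toNat_sub_toNat_neg]
    rw [hb fun i => (g i).toNat, hb fun i => (-g i).toNat] at h
    have h' : (g i).toNat = (-g i).toNat := congrFun (e.symm.injective (Subtype.ext h)) i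
    omega
  · rintro _ ⟨i, rfl⟩
    exact (e.symm (Pi.single i 1)).2
  · have := hb (e ⟨x, hx⟩)
    rw [e.symm_apply_apply] at this
    change _ = x at this
    rw [← this]
    exact sum_mem fun i _ => nsmul_mem (AddSubmonoid.subset_closure (Set.mem_range_self i)) _

lemma nonempty_addEquiv_of_linearIndependent {m : ℕ} {b : Fin m → G}
    (hb : LinearIndependent ℤ b) :
    Nonempty (AddSubmonoid.closure (Set.range b) ≃+ (Fin m → ℕ)) := by
  let f : (Fin m → ℕ) →+ G := (Fintype.linearCombination ℕ b).toAddMonoidHom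
  have hf : ∀ n, f n = ∑ i, n i • b i := fun n => rfl
  have hinj : Function.Injective f := by
    intro n n' h
    rw [hf, hf, ← sub_eq_zero, ← Finset.sum_sub_distrib] at h
    funext i
    have := Fintype.linearIndependent_iff.1 hb (fun i => (n i : ℤ) - n' i) (by
      rw [← h]
      exact Finset.sum_congr rfl fun i _ => by rw [sub_smul, natCast_zsmul, natCast_zsmul]) i
    omega
  have hrange : AddMonoidHom.mrange f = AddSubmonoid.closure (Set.range b) := by
    have h := congrArg Submodule.toAddSubmonoid (Fintype.range_linearCombination ℕ b)
    rw [Submodule.span_nat_eq_addSubmonoidClosure] at h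
    exact h
  rw [← hrange]
  exact ⟨(AddEquiv.ofBijective f.mrangeRestrict ⟨fun x y h => hinj (congrArg Subtype.val h),
    f.mrangeRestrict_surjective⟩).symm⟩

lemma isCompletelyGluedAffine_iff {n : ℕ} {S : AddSubmonoid (Fin n → ℤ)} :
    IsCompletelyGluedAffine S ↔ IsCompletelyGlued S := by
  refine ⟨fun h => ?_, fun h => ?_⟩
  · induction h with
    | of_free F k hF =>
      obtain ⟨b, hb, rfl⟩ := exists_linearIndependent_of_addEquiv hF.some
      exact .of_linearIndependent b hb
    | glue a E₁ E₂ ha h _ _ ih₁ ih₂ => exact .glue a E₁ E₂ ha h ih₁ ih₂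
  · induction h with
    | of_linearIndependent b hb =>
      exact .of_free _ _ (nonempty_addEquiv_of_linearIndependent hb)
    | glue a E₁ E₂ ha h _ _ ih₁ ih₂ => exact .glue a E₁ E₂ ha h ih₁ ih₂

end Affine

theorem theorem3p16 :
    (∀ (G : Type u) [AddCommGroup G] (S : AddSubmonoid G), HasNoInvertibles S →
      ∀ (m : ℕ) (a : Fin m → G), AddSubmonoid.closure (Set.range a) = S →
        (IsCompleteIntersectionSemigroup a ↔ IsCompletelyGlued S)) ∧
    (∀ (n : ℕ) (S : AddSubmonoid (Fin n → ℤ)), HasNoInvertibles S →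
      ∀ (m : ℕ) (a : Fin m → Fin n → ℤ), AddSubmonoid.closure (Set.range a) = S →
        (IsCompleteIntersectionSemigroup a ↔ IsCompletelyGluedAffine S)) := by
  refine ⟨?_, ?_⟩
  · rintro G _ S hS m a rfl
    rw [isCompleteIntersectionSemigroup_iff, hasFewGenerators_iff_isCompletelyGlued hS]
  · rintro n S hS m a rfl
    rw [isCompleteIntersectionSemigroup_iff, hasFewGenerators_iff_isCompletelyGlued hS,
      isCompletelyGluedAffine_iff]
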